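/- For an increasing function $\varphi:[0,\infty)\to\mathbb R$ let $$\mathcal F_\varphi=\Bigl\{f \text{ entire}:\ \|f\|_\varphi^2=\int_{\mathbb C}|f(z)|^2e^{-2\varphi(|z|)}\,dm(z)<\infty\Bigr\},$$ where $m$ is area Lebesgue measure on $\mathbb C$, with the inner product $\langle f,g\rangle_\varphi=\int_{\mathbb C} f\,\overline g\,e^{-2\varphi(|z|)}\,dm(z)$. It is a Hilbert space in which point evaluations are bounded. Let $\mathbf k_\lambda\in\mathcal F_\varphi$ be the reproducing kernel at $\lambda\in\mathbb C$, that is, $f(\lambda)=\langle f,\mathbf k_\lambda\rangle_\varphi$ for all $f\in\mathcal F_\varphi$, and let $\Bbbk_\lambda=\mathbf k_\lambda/\|\mathbf k_\lambda\|_\varphi$. **Theorem.** Let $0<\delta<1$ and $\varphi(r)=(\log^+r)^{1+\delta}$, where $\log^+ r=\max(\log r,0)$ and $\log^+0=0$. Put $w_n=\log\|z^n\|_\varphi^2$ for $n\ge 0$, and $r_0=0$, $r_n=\exp\bigl((w_{n+1}-w_{n-1})/4\bigr)$ for $n\ge1$. Let $(\theta_n)_{n\ge0}$ be arbitrary real numbers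 and $\lambda_n=r_ne^{i\theta_n}$. Then $\{\Bbbk_{\lambda_n}\}_{n\ge0}$ is a Riesz basis of $\mathcal F_\varphi$: its linear span is dense in $\mathcal F_\varphi$, and there are constants $c,C>0$ such that $$c\sum_n|a_n|^2\le\Bigl\|\sum_n a_n\Bbbk_{\lambda_n}\Bigr\|_\varphi^2\le C\sum_n|a_n|^2$$ for every finitely supported sequence of complex numbers $(a_n)_{n\ge0}$. -/

import Mathlib

open MeasureTheory Filter Topology
open scoped NNReal ENNReal InnerProductSpace

noncomputable section

namespace Fock

/-- Area mean value inequality for `|f|²` on a unit disc. -/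
theorem pi_mul_enorm_sq_le {f : ℂ → ℂ} (hf : Differentiable ℂ f) (c : ℂ) :
    ENNReal.ofReal Real.pi * ‖f c‖ₑ ^ 2 ≤ ∫⁻ z in Metric.ball c 1, ‖f z‖ₑ ^ 2 := by
  have hc : ∀ r : ℝ, Continuous fun θ : ℝ => f (circleMap c r θ) :=
    fun r => hf.continuous.comp (continuous_circleMap c r)
  have h1 (r : ℝ) : ENNReal.ofReal (2 * Real.pi) * ‖f c‖ₑ ^ 2 ≤
      ∫⁻ θ in Set.Ioo (-Real.pi) Real.pi, ‖f (circleMap c r θ)‖ₑ ^ 2 := by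
    have hm : Real.circleAverage (fun z => f z ^ 2) c r = f c ^ 2 :=
      DiffContOnCl.circleAverage (hf.pow 2).diffContOnCl
    rw [Real.circleAverage_eq_integral_add (-Real.pi)] at hm
    rw [intervalIntegral.integral_comp_add_right (fun θ => f (circleMap c r θ) ^ 2)] at hm
    rw [show (0 : ℝ) + -Real.pi = -Real.pi by ring,
      show 2 * Real.pi + -Real.pi = Real.pi by ring,
      intervalIntegral.integral_of_le (by linarith [Real.pi_pos]),
      integral_Ioc_eq_integral_Ioo] at hm
    have h2 : (∫ θ in Set.Ioo (-Real.pi) Real.pi, f (circleMap c r θ) ^ 2) =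
        (2 * Real.pi : ℝ) • f c ^ 2 := by
      rw [← hm, smul_smul, mul_inv_cancel₀ (by positivity), one_smul]
    calc ENNReal.ofReal (2 * Real.pi) * ‖f c‖ₑ ^ 2
        = ‖(2 * Real.pi : ℝ) • f c ^ 2‖ₑ := by
          rw [enorm_smul, enorm_pow, Real.enorm_eq_ofReal (by positivity)]
      _ ≤ ∫⁻ θ in Set.Ioo (-Real.pi) Real.pi, ‖f (circleMap c r θ) ^ 2‖ₑ := by
          rw [← h2]; exact enorm_integral_le_lintegral_enorm _
      _ = _ := by simp_rw [enorm_pow]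
  set g : ℂ → ℝ≥0∞ := (Metric.ball c 1).indicator fun z => ‖f z‖ₑ ^ 2 with hg
  have hgm : Measurable g := by
    refine Measurable.indicator ?_ measurableSet_ball
    have := hf.continuous.measurable
    fun_prop
  have hpm : Measurable fun p : ℝ × ℝ => ENNReal.ofReal p.1 * g (c + Complex.polarCoord.symm p) := by
    simp only [Complex.polarCoord_symm_apply]
    fun_prop
  rw [← lintegral_indicator measurableSet_ball, ← lintegral_add_left_eq_self g c,
    ← Complex.lintegral_comp_polarCoord_symm, show polarCoord.target = Set.Ioi (0 : ℝ) ×ˢ Set.Ioo (-Real.pi) Real.pi from rfl]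
  simp only [smul_eq_mul]
  rw [Measure.volume_eq_prod, ← Measure.prod_restrict, lintegral_prod _ hpm.aemeasurable]
  have hr : ∀ r ∈ Set.Ioo (0 : ℝ) 1, ENNReal.ofReal r * (ENNReal.ofReal (2 * Real.pi) * ‖f c‖ₑ ^ 2) ≤
      ∫⁻ θ in Set.Ioo (-Real.pi) Real.pi,
        ENNReal.ofReal r * g (c + Complex.polarCoord.symm (r, θ)) := by
    intro r hr
    rw [lintegral_const_mul']
    · gcongr
      refine (h1 r).trans (lintegral_mono fun θ => ?_)
      have hp : c + Complex.polarCoord.symm (r, θ) = circleMap c r θ := by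
        simp [circleMap, Complex.exp_mul_I]
      rw [hp, hg, Set.indicator_of_mem]
      simp [circleMap, abs_of_pos hr.1, hr.2]
    · simp
  calc ENNReal.ofReal Real.pi * ‖f c‖ₑ ^ 2
      = ∫⁻ r in Set.Ioo (0 : ℝ) 1, ENNReal.ofReal r * (ENNReal.ofReal (2 * Real.pi) * ‖f c‖ₑ ^ 2) := by
        rw [lintegral_mul_const _ (by fun_prop), ← ofReal_integral_eq_lintegral_ofReal, ← integral_Ioc_eq_integral_Ioo, ← intervalIntegral.integral_of_le zero_le_one, integral_id, ← mul_assoc, ← ENNReal.ofReal_mul (by norm_num)]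
        · congr 2; ring
        · exact (continuous_id.integrableOn_Icc (a := 0) (b := 1)).mono_set Set.Ioo_subset_Icc_self
        · filter_upwards [ae_restrict_mem measurableSet_Ioo] with r hr using hr.1.le
    _ ≤ ∫⁻ r in Set.Ioo (0 : ℝ) 1, ∫⁻ θ in Set.Ioo (-Real.pi) Real.pi,
        ENNReal.ofReal r * g (c + Complex.polarCoord.symm (r, θ)) :=
        setLIntegral_mono' measurableSet_Ioo hr
    _ ≤ _ := lintegral_mono_set fun r hr => hr.1

/-- The weighted area measure `e^{-2 φ(|z|)} dm(z)` on `ℂ` attached to an increasing function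
`φ` on `[0, ∞)`. -/
def fockMeasure (φ : ℝ≥0 →o ℝ) : Measure ℂ :=
  volume.withDensity fun z => ENNReal.ofReal (Real.exp (-2 * φ ‖z‖₊))

/-- The entire functions that are square integrable for the weighted area measure. -/
def fockSubmodule (φ : ℝ≥0 →o ℝ) : Submodule ℂ (ℂ → ℂ) where
  carrier := {f | Differentiable ℂ f ∧ MemLp f 2 (fockMeasure φ)}
  zero_mem' := ⟨differentiable_const 0, MemLp.zero⟩
  add_mem' hf hg := ⟨hf.1.add hg.1, hf.2.add hg.2⟩
  smul_mem' c _ hf := ⟨hf.1.const_smul c, hf.2.const_smul c⟩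

/-- The Fock type space `F_φ`. A type of its own, so that it carries the norm of `F_φ` and not the
topology of pointwise convergence. -/
def FockSpace (φ : ℝ≥0 →o ℝ) : Type := fockSubmodule φ

namespace FockSpace

variable (φ : ℝ≥0 →o ℝ)

instance : AddCommGroup (FockSpace φ) := inferInstanceAs (AddCommGroup (fockSubmodule φ))

instance : Module ℂ (FockSpace φ) := inferInstanceAs (Module ℂ (fockSubmodule φ))

/-- The entire function underlying an element of `F_φ`. -/
def toFun : FockSpace φ →ₗ[ℂ] ℂ → ℂ := (fockSubmodule φ).subtype

theorem differentiable_toFun (f : FockSpace φ) : Differentiable ℂ (toFun φ f) := f.2.1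

theorem memLp_toFun (f : FockSpace φ) : MemLp (toFun φ f) 2 (fockMeasure φ) := f.2.2

theorem toFun_injective : Function.Injective (toFun φ) := (fockSubmodule φ).injective_subtype

theorem measurable_weight :
    Measurable fun z : ℂ => ENNReal.ofReal (Real.exp (-2 * φ ‖z‖₊)) := by
  have := φ.monotone.measurable
  fun_prop

theorem volume_absolutelyContinuous : (volume : Measure ℂ) ≪ fockMeasure φ :=
  withDensity_absolutelyContinuous' (measurable_weight φ).aemeasurable
    (Eventually.of_forall fun z => by simp [Real.exp_pos])

/-- The class of `f ∈ F_φ` in `L²(e^{-2φ} dm)`. -/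
def toL2 : FockSpace φ →ₗ[ℂ] Lp ℂ 2 (fockMeasure φ) where
  toFun f := (memLp_toFun φ f).toLp _
  map_add' f g := MemLp.toLp_add (memLp_toFun φ f) (memLp_toFun φ g)
  map_smul' c f := MemLp.toLp_const_smul c (memLp_toFun φ f)

theorem coeFn_toL2 (f : FockSpace φ) : toL2 φ f =ᵐ[fockMeasure φ] toFun φ f :=
  MemLp.coeFn_toLp (memLp_toFun φ f)

theorem toL2_injective : Function.Injective (toL2 φ) := by
  intro f g h
  apply toFun_injective φ
  have h1 : toFun φ f =ᵐ[fockMeasure φ] toFun φ g :=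
    (coeFn_toL2 φ f).symm.trans (h ▸ coeFn_toL2 φ g)
  exact Measure.eq_of_ae_eq ((volume_absolutelyContinuous φ).ae_eq h1)
    (differentiable_toFun φ f).continuous (differentiable_toFun φ g).continuous

/-- The norm of `F_φ` is the one of `L²(e^{-2φ} dm)`. -/
instance : NormedAddCommGroup (FockSpace φ) :=
  NormedAddCommGroup.induced _ _ (toL2 φ) (toL2_injective φ)

/-- The inner product of `F_φ` is the one of `L²(e^{-2φ} dm)`. -/
instance : InnerProductSpace ℂ (FockSpace φ) where
  norm_smul_le c f := by
    change ‖toL2 φ (c • f)‖ ≤ ‖c‖ * ‖toL2 φ f‖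
    rw [map_smul]
    exact norm_smul_le _ _
  inner f g := inner ℂ (toL2 φ f) (toL2 φ g)
  norm_sq_eq_re_inner f := norm_sq_eq_re_inner (toL2 φ f)
  conj_inner_symm f g := inner_conj_symm (toL2 φ f) (toL2 φ g)
  add_left f g h := by
    change inner ℂ (toL2 φ (f + g)) _ = _
    rw [map_add]
    exact inner_add_left _ _ _
  smul_left f g c := by
    change inner ℂ (toL2 φ (c • f)) _ = _
    rw [map_smul]
    exact inner_smul_left _ _ _

theorem norm_eq (f : FockSpace φ) : ‖f‖ = ‖toL2 φ f‖ := rfl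

theorem inner_eq (f g : FockSpace φ) : ⟪f, g⟫_ℂ = ⟪toL2 φ f, toL2 φ g⟫_ℂ := rfl

/-- `⟪f, g⟫ = ∫ conj (f z) g(z) e^{-2φ(z)} dm(z)`: conjugate-linear in the first variable. -/
theorem inner_eq_integral (f g : FockSpace φ) :
    ⟪f, g⟫_ℂ = ∫ z : ℂ, (Real.exp (-2 * φ ‖z‖₊) : ℂ) *
      (starRingEnd ℂ (toFun φ f z) * toFun φ g z) := by
  have h : ⟪f, g⟫_ℂ = ∫ z, starRingEnd ℂ (toFun φ f z) * toFun φ g z ∂(fockMeasure φ) := by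
    rw [inner_eq, L2.inner_def]
    refine integral_congr_ae ?_
    filter_upwards [coeFn_toL2 φ f, coeFn_toL2 φ g] with z h1 h2
    rw [h1, h2, RCLike.inner_apply, mul_comm]
  rw [h, fockMeasure, integral_withDensity_eq_integral_toReal_smul (measurable_weight φ)
    (by simp)]
  refine integral_congr_ae (Eventually.of_forall fun z => ?_)
  simp [ENNReal.toReal_ofReal (Real.exp_pos _).le]

/-- `‖f‖² = ∫ |f(z)|² e^{-2φ(z)} dm(z)`. -/
theorem norm_sq_eq_integral (f : FockSpace φ) :
    ‖f‖ ^ 2 = ∫ z : ℂ, ‖toFun φ f z‖ ^ 2 * Real.exp (-2 * φ ‖z‖₊) := by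
  have h : ((‖f‖ ^ 2 : ℝ) : ℂ) =
      ((∫ z : ℂ, ‖toFun φ f z‖ ^ 2 * Real.exp (-2 * φ ‖z‖₊) : ℝ) : ℂ) := by
    rw [← integral_complex_ofReal]
    push_cast
    have := inner_self_eq_norm_sq_to_K (𝕜 := ℂ) f
    rw [inner_eq_integral] at this
    rw [← Complex.coe_algebraMap] at *
    refine Eq.trans this.symm (integral_congr_ae (Eventually.of_forall fun z => ?_))
    have := Complex.conj_mul' (toFun φ f z)
    simp only [this, mul_comm]
    simp
  exact_mod_cast h

theorem lintegral_toFun (f : FockSpace φ) :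
    ∫⁻ z, ‖toFun φ f z‖ₑ ^ 2 ∂(fockMeasure φ) = ENNReal.ofReal (‖f‖ ^ 2) := by
  rw [norm_eq, show toL2 φ f = (memLp_toFun φ f).toLp _ from rfl, Lp.norm_toLp,
    ENNReal.ofReal_pow ENNReal.toReal_nonneg, ENNReal.ofReal_toReal (memLp_toFun φ f).2.ne,
    eLpNorm_eq_lintegral_rpow_enorm_toReal (by simp) (by simp)]
  simp only [ENNReal.toReal_ofNat, ENNReal.rpow_ofNat, one_div]
  rw [← ENNReal.rpow_natCast, ← ENNReal.rpow_mul]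
  simp

/-- Point evaluations are bounded on `F_φ`, uniformly on discs. -/
theorem norm_toFun_le (f : FockSpace φ) (R : ℝ≥0) (c : ℂ) (hc : ‖c‖₊ ≤ R) :
    ‖toFun φ f c‖ ≤ Real.exp (φ (R + 1)) * ‖f‖ := by
  have h1 := pi_mul_enorm_sq_le (differentiable_toFun φ f) c
  have hm : Measurable fun z => ‖toFun φ f z‖ₑ ^ 2 := by
    have := (differentiable_toFun φ f).continuous.measurable
    fun_prop
  have h2 : ∫⁻ z in Metric.ball c 1, ‖toFun φ f z‖ₑ ^ 2 ≤
      ENNReal.ofReal (Real.exp (2 * φ (R + 1))) * ENNReal.ofReal (‖f‖ ^ 2) := by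
    rw [← lintegral_toFun φ f, fockMeasure,
      lintegral_withDensity_eq_lintegral_mul _ (measurable_weight φ) hm,
      ← lintegral_const_mul _ ((measurable_weight φ).mul hm)]
    refine (setLIntegral_mono' measurableSet_ball fun z hz => ?_).trans (setLIntegral_le_lintegral _ _)
    simp only [Pi.mul_apply]
    rw [← mul_assoc, ← ENNReal.ofReal_mul (Real.exp_pos _).le, ← Real.exp_add]
    have hz' : ‖z‖₊ ≤ R + 1 := by
      have h3 : ‖z‖ ≤ ‖c‖ + ‖z - c‖ := by simpa using norm_add_le c (z - c)
      have h4 : ‖z - c‖ < 1 := by simpa [dist_eq_norm] using hz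
      have h5 : ‖c‖ ≤ R := hc
      rw [← NNReal.coe_le_coe]
      push_cast
      linarith
    have h6 := φ.monotone hz'
    refine le_mul_of_one_le_left zero_le ?_
    rw [ENNReal.one_le_ofReal, Real.one_le_exp_iff]
    linarith
  have h3 : ‖toFun φ f c‖ₑ ^ 2 ≤ ENNReal.ofReal ((Real.exp (φ (R + 1)) * ‖f‖) ^ 2) := by
    calc ‖toFun φ f c‖ₑ ^ 2 ≤ ENNReal.ofReal Real.pi * ‖toFun φ f c‖ₑ ^ 2 := by
          refine le_mul_of_one_le_left zero_le ?_
          rw [ENNReal.one_le_ofReal]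
          linarith [Real.pi_gt_three]
      _ ≤ _ := h1.trans h2
      _ = _ := by
          rw [← ENNReal.ofReal_mul (Real.exp_pos _).le, mul_pow, ← Real.exp_nat_mul]
          norm_num
  rw [← ofReal_norm, ← ENNReal.ofReal_pow (norm_nonneg _),
    ENNReal.ofReal_le_ofReal_iff (by positivity)] at h3
  exact le_of_sq_le_sq h3 (by positivity)

/-- `F_φ` as a space of functions with continuous point evaluations. -/
instance : RKHS ℂ (FockSpace φ) ℂ ℂ where
  coeCLM :=
    { toLinearMap := toFun φ
      cont := continuous_pi fun z =>
        (((LinearMap.proj z).comp (toFun φ)).mkContinuous (Real.exp (φ (‖z‖₊ + 1)))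
          fun f => norm_toFun_le φ f ‖z‖₊ z le_rfl).continuous }
  coeCLM_injective := toFun_injective φ

theorem coe_eq_toFun (f : FockSpace φ) : ⇑f = toFun φ f := rfl

theorem isometry_toL2 : Isometry (toL2 φ) :=
  AddMonoidHomClass.isometry_of_norm (toL2 φ) fun _ => rfl

theorem isClosed_range_toL2 : IsClosed (Set.range (toL2 φ)) := by
  refine IsSeqClosed.isClosed fun u g hu hg => ?_
  choose f hf using hu
  obtain rfl : u = fun n => toL2 φ (f n) := funext fun n => (hf n).symm
  have hcau : CauchySeq f :=
    (isometry_toL2 φ).isUniformInducing.cauchy_map_iff.1 hg.cauchySeq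
  have hunif (R : ℝ≥0) :
      UniformCauchySeqOn (fun n => toFun φ (f n)) atTop (Metric.closedBall 0 R) := by
    rw [Metric.uniformCauchySeqOn_iff]
    intro ε hε
    obtain ⟨N, hN⟩ := Metric.cauchySeq_iff.1 hcau (ε / Real.exp (φ (R + 1))) (by positivity)
    refine ⟨N, fun m hm n hn z hz => ?_⟩
    have h1 := norm_toFun_le φ (f m - f n) R z 
      (by rw [← NNReal.coe_le_coe]; simpa using hz)
    have h2 := hN m hm n hn
    rw [dist_eq_norm, lt_div_iff₀ (Real.exp_pos _)] at h2
    rw [dist_eq_norm, ← Pi.sub_apply, ← map_sub]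
    linarith
  have hcz (z : ℂ) : CauchySeq fun n => toFun φ (f n) z :=
    (hunif ‖z‖₊).cauchySeq (by simp)
  choose F hF using fun z => cauchySeq_tendsto_of_complete (hcz z)
  have hFd : Differentiable ℂ F := by
    rw [← differentiableOn_univ]
    refine TendstoLocallyUniformlyOn.differentiableOn (F := fun n => toFun φ (f n)) (φ := atTop)
      ?_ (Eventually.of_forall fun n => (differentiable_toFun φ (f n)).differentiableOn) isOpen_univ
    rw [tendstoLocallyUniformlyOn_iff_forall_isCompact isOpen_univ]
    intro K _ hK
    obtain ⟨R, hR⟩ := hK.isBounded.subset_closedBall 0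
    exact ((hunif R.toNNReal).tendstoUniformlyOn_of_tendsto fun z _ => hF z).mono
      (hR.trans (Metric.closedBall_subset_closedBall (Real.le_coe_toNNReal R)))
  obtain ⟨ns, hns, hae⟩ := (tendstoInMeasure_of_tendsto_Lp hg).exists_seq_tendsto_ae
  have hFg : g =ᵐ[fockMeasure φ] F := by
    filter_upwards [hae, ae_all_iff.2 fun n => coeFn_toL2 φ (f n)] with z h1 h2
    simp only [h2] at h1
    exact tendsto_nhds_unique h1 ((hF z).comp hns.tendsto_atTop)
  refine ⟨⟨F, hFd, (memLp_congr_ae hFg).1 (Lp.memLp g)⟩, Lp.ext ?_⟩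
  exact (coeFn_toL2 φ _).trans hFg.symm

instance : CompleteSpace (FockSpace φ) :=
  (completeSpace_iff_isComplete_range (isometry_toL2 φ).isUniformInducing).2
    (isClosed_range_toL2 φ).isComplete

end FockSpace

/-- The weight `φ(r) = (log⁺ r)^{1+δ}`. -/
def logWeight (δ : ℝ) (hδ : 0 < δ) : ℝ≥0 →o ℝ where
  toFun r := (Real.posLog r) ^ (1 + δ)
  monotone' r s hrs := by
    refine Real.rpow_le_rpow Real.posLog_nonneg ?_ (by linarith)
    exact Real.monotoneOn_posLog r.2 s.2 hrs

theorem linear_le_add_rpow {δ A t : ℝ} (hδ : 0 < δ) (hA : 0 ≤ A) (ht : 0 ≤ t) :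
    A * t ≤ A * A ^ δ⁻¹ + t ^ (1 + δ) := by
  rcases le_total t (A ^ δ⁻¹) with h | h
  · have := mul_le_mul_of_nonneg_left h hA
    have := Real.rpow_nonneg ht (1 + δ)
    linarith
  · have h1 : A ≤ t ^ δ := by
      calc A = (A ^ δ⁻¹) ^ δ := by rw [← Real.rpow_mul hA, inv_mul_cancel₀ hδ.ne', Real.rpow_one]
        _ ≤ t ^ δ := Real.rpow_le_rpow (Real.rpow_nonneg hA _) h hδ.le
    have h2 : t ^ (1 + δ) = t ^ δ * t := by
      rw [add_comm, Real.rpow_add_one' ht (by linarith)]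
    have h3 := mul_le_mul_of_nonneg_right h1 ht
    have h4 : 0 ≤ A * A ^ δ⁻¹ := mul_nonneg hA (Real.rpow_nonneg hA _)
    linarith

theorem memLp_pow (δ : ℝ) (hδ : 0 < δ) (n : ℕ) :
    MemLp (fun z : ℂ => z ^ n) 2 (fockMeasure (logWeight δ hδ)) := by
  rw [memLp_two_iff_integrable_sq_norm (by fun_prop), fockMeasure,
    integrable_withDensity_iff_integrable_smul₀' (FockSpace.measurable_weight _).aemeasurable
      (by simp)]
  have hint : Integrable (fun z : ℂ => (1 + ‖z‖) ^ (-(3 : ℝ))) :=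
    integrable_one_add_norm (by rw [Complex.finrank_real_complex]; norm_num)
  set A : ℝ := 2 * n + 3 with hA
  have hA0 : 0 ≤ A := by positivity
  refine (hint.const_mul (Real.exp (A * Real.log 2 + A * A ^ δ⁻¹))).mono' ?_ ?_
  · have h := (FockSpace.measurable_weight (logWeight δ hδ)).ennreal_toReal
    exact (h.smul (by fun_prop : Measurable fun z : ℂ => ‖z ^ n‖ ^ 2)).aestronglyMeasurable
  · refine Eventually.of_forall fun z => ?_
    set t := Real.posLog ‖z‖ with ht
    have ht0 : 0 ≤ t := Real.posLog_nonneg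
    have hlog : Real.log (1 + ‖z‖) ≤ Real.log 2 + t := by
      have h1 := Real.posLog_add (x := 1) (y := ‖z‖)
      rw [Real.posLog_eq_log (x := 1 + ‖z‖)] at h1
      · simpa using h1
      · rw [abs_of_pos (by positivity)]; linarith [norm_nonneg z]
    have hpow : ‖z‖ ^ (2 * n) ≤ Real.exp (A * Real.log (1 + ‖z‖)) * (1 + ‖z‖) ^ (-(3 : ℝ)) := by
      have h0 : (0 : ℝ) < 1 + ‖z‖ := by positivity
      rw [mul_comm A, ← Real.rpow_def_of_pos h0, ← Real.rpow_add h0,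
        show A + -3 = ((2 * n : ℕ) : ℝ) by rw [hA]; push_cast; ring, Real.rpow_natCast]
      exact pow_le_pow_left₀ (norm_nonneg _) (by linarith) _
    have hb := linear_le_add_rpow hδ hA0 ht0
    have hw : logWeight δ hδ ‖z‖₊ = t ^ (1 + δ) := rfl
    have hw0 : 0 ≤ t ^ (1 + δ) := Real.rpow_nonneg ht0 _
    rw [hw, ENNReal.toReal_ofReal (Real.exp_pos _).le, smul_eq_mul, norm_pow, ← pow_mul,
      mul_comm n 2, Real.norm_of_nonneg (by positivity)]
    calc Real.exp (-2 * t ^ (1 + δ)) * ‖z‖ ^ (2 * n)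
        ≤ Real.exp (-2 * t ^ (1 + δ)) *
          (Real.exp (A * Real.log (1 + ‖z‖)) * (1 + ‖z‖) ^ (-(3 : ℝ))) := by gcongr
      _ = Real.exp (-2 * t ^ (1 + δ) + A * Real.log (1 + ‖z‖)) * (1 + ‖z‖) ^ (-(3 : ℝ)) := by
          rw [Real.exp_add, mul_assoc]
      _ ≤ _ := by
          refine mul_le_mul_of_nonneg_right (Real.exp_le_exp.2 ?_) (by positivity)
          have := mul_le_mul_of_nonneg_left hlog hA0
          linarith

/-- The monomial `zⁿ` as an element of `F_φ`, `φ(r) = (log⁺ r)^{1+δ}`. -/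
def monomial (δ : ℝ) (hδ : 0 < δ) (n : ℕ) : FockSpace (logWeight δ hδ) :=
  ⟨fun z => z ^ n, differentiable_pow n, memLp_pow δ hδ n⟩

/-- `w_n = log ‖zⁿ‖²_φ`. -/
def logNormSq (δ : ℝ) (hδ : 0 < δ) (n : ℕ) : ℝ := Real.log (‖monomial δ hδ n‖ ^ 2)

/-- `r_0 = 0` and `r_n = exp ((w_{n+1} - w_{n-1}) / 4)` for `n ≥ 1`. -/
def radius (δ : ℝ) (hδ : 0 < δ) : ℕ → ℝ
  | 0 => 0
  | n + 1 => Real.exp ((logNormSq δ hδ (n + 2) - logNormSq δ hδ n) / 4)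

/-- The normalized reproducing kernel `k_z / ‖k_z‖` of `F_φ` at `z`. Here
`RKHS.kerFun (FockSpace φ) z 1` is the element `k_z` of `F_φ` with `⟪k_z, f⟫ = f z` for all `f`. -/
def normalizedKernel (φ : ℝ≥0 →o ℝ) (z : ℂ) : FockSpace φ :=
  ((‖RKHS.kerFun (FockSpace φ) z 1‖⁻¹ : ℝ) : ℂ) • RKHS.kerFun (FockSpace φ) z 1

/-- A family in a complex inner product space is a Riesz basis if its linear span is dense and
`c ∑ |a_i|² ≤ ‖∑ a_i v_i‖² ≤ C ∑ |a_i|²` for all finite families of coefficients, with constants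
`c, C > 0`. -/
structure IsRieszBasis {ι H : Type*} [NormedAddCommGroup H] [InnerProductSpace ℂ H]
    (v : ι → H) : Prop where
  complete : (Submodule.span ℂ (Set.range v)).topologicalClosure = ⊤
  bounds : ∃ c C : ℝ, 0 < c ∧ 0 < C ∧ ∀ (s : Finset ι) (a : ι → ℂ),
    c * ∑ i ∈ s, ‖a i‖ ^ 2 ≤ ‖∑ i ∈ s, a i • v i‖ ^ 2 ∧
      ‖∑ i ∈ s, a i • v i‖ ^ 2 ≤ C * ∑ i ∈ s, ‖a i‖ ^ 2

end Fock

end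

/-!
The monomials are orthogonal in `F_φ`, so the kernel at `z` has squared norm `∑ₘ |z|²ᵐ e^{-wₘ}`.
Let `Δₙ = wₙ₊₁ - 2 wₙ + wₙ₋₁`. At `|z| = rₙ` the exponent `m ↦ 2 m log rₙ - wₘ` is concave, its
maximum is at `m = n`, and it drops by at least `Δₙ / 2` at each step away from `n`. The kernel
`k_{λₙ}` is therefore concentrated on a single coefficient: up to a unimodular factor its
normalization differs from `zⁿ / ‖zⁿ‖` by at most `2 e^{-Δₙ / 4}` in norm, for large `n`
(`norm_kerFun_sq_le`, `norm_normalizedKernel_sub_sq_le`).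

The hypothesis `δ < 1` enters through the growth of `Δₙ` (`eventually_le_secondDifference`).
Dilating the integrals for `wₙ₋₁` and `wₙ₊₁` by `e^{-a}` and `e^{a}` and applying the Cauchy–Schwarz
inequality gives `Δₙ ≥ 4 a - O(1)`, provided that `(t + a)^{1+δ} + (t - a)^{1+δ} - 2 t^{1+δ}` is
bounded where `|zⁿ|² e^{-2φ}` has its mass. As this symmetric difference is at most
`2 δ a² t^{δ-1}`, one can take `a = 2 log n`, and `∑ₙ e^{-Δₙ / 4}` converges.

Thus the normalized kernels, after a unimodular change of the orthonormal basis, form a perturbation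
of a Hilbert basis with summable errors. For such a family completeness alone implies the Riesz
basis property, by the Fredholm alternative (`isRieszBasis_of_summable_norm_sub`). Completeness
means that an `f ∈ F_φ` vanishing at every `λₙ` is zero (`eq_zero_of_forall_toFun_eq_zero`).
If `f = zᵏ g` with `k ≥ 1`, dividing the zeros out of `g` by Blaschke factors of the disc of radius
`r_N` (`norm_apply_zero_le_of_zeros`) and estimating `|f|` on the circle by the norm of the kernel
gives `|g(0)| ≤ C exp ((w_{N-1} - w_N - w₁ - w₀) / 4)`, and this tends to `0`.
-/

namespace Fock

/-! ### Summable perturbations of a Hilbert basis -/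

/-- A complete system whose distances to a Hilbert basis `b` are summable is a Riesz basis. The
operator `A = 1 + ∑ₙ ⟪vₙ - bₙ, ·⟫ bₙ` is a compact perturbation of the identity, completeness of `v`
makes it injective, hence invertible, and its adjoint maps `bₙ` to `vₙ`. -/
theorem isRieszBasis_of_summable_norm_sub {H : Type*} [NormedAddCommGroup H]
    [InnerProductSpace ℂ H] [CompleteSpace H] (b : HilbertBasis ℕ ℂ H) {v : ℕ → H}
    (hs : Summable fun n => ‖v n - b n‖)
    (hd : (Submodule.span ℂ (Set.range v)).topologicalClosure = ⊤) : IsRieszBasis v := by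
  have hb (n : ℕ) : ‖b n‖ = 1 := b.orthonormal.1 n
  have hsum : Summable fun n => InnerProductSpace.rankOne ℂ (b n) (v n - b n) :=
    Summable.of_norm (by simpa only [InnerProductSpace.norm_rankOne, hb, one_mul] using hs)
  set K : H →L[ℂ] H := ∑' n, InnerProductSpace.rankOne ℂ (b n) (v n - b n) with hK
  have hKc : IsCompactOperator K := by
    refine isCompactOperator_of_tendsto hsum.hasSum (Eventually.of_forall fun s => ?_)
    refine (Submodule.sum_mem (compactOperator (RingHom.id ℂ) H H) fun n _ => ?_ :)
    have h1 : IsCompactOperator (innerSL ℂ (v n - b n) : H →L[ℂ] ℂ) :=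
      isCompactOperator_of_locallyCompactSpace_dom _
    exact h1.clm_comp (ContinuousLinearMap.toSpanSingleton ℂ (b n))
  set A : H →L[ℂ] H := 1 + K with hA
  have hbA (n : ℕ) (f : H) : ⟪b n, A f⟫_ℂ = ⟪v n, f⟫_ℂ := by
    have h1 : HasSum (fun m => ⟪b n, InnerProductSpace.rankOne ℂ (b m) (v m - b m) f⟫_ℂ)
        ⟪b n, K f⟫_ℂ :=
      (hsum.hasSum.mapL (ContinuousLinearMap.apply ℂ H f)).mapL (innerSL ℂ (b n))
    have h2 := h1.unique (hasSum_single n fun m hm => by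
      simp [b.orthonormal.2 hm.symm])
    rw [hA, add_apply, inner_add_right, h2]
    simp [hb, inner_self_eq_norm_sq_to_K]
  have hinj (f : H) (hf : A f = 0) : f = 0 := by
    have h1 : f ∈ (Submodule.span ℂ (Set.range v))ᗮ := by
      rw [Submodule.mem_orthogonal]
      intro u hu
      induction hu using Submodule.span_induction with
      | mem x hx => obtain ⟨n, rfl⟩ := hx; rw [← hbA, hf, inner_zero_right]
      | zero => exact inner_zero_left _
      | add x y _ _ hx hy => rw [inner_add_left, hx, hy, add_zero]
      | smul c x _ hx => rw [inner_smul_left, hx, mul_zero]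
    rw [Submodule.topologicalClosure_eq_top_iff.1 hd] at h1
    simpa using h1
  have hunit : IsUnit A := by
    rcases hKc.hasEigenvalue_or_mem_resolventSet (μ := (-1 : ℂ)) (by norm_num) with h | h
    · obtain ⟨f, hf⟩ := h.exists_hasEigenvector
      refine absurd (hinj f ?_) hf.2
      have := hf.apply_eq_smul
      simp at this
      simp [hA, this]
    · rw [spectrum.mem_resolventSet_iff] at h
      rw [← IsUnit.neg_iff]
      convert! h using 1
      ext x; simp [hA]; abel
  -- the adjoint of `A` maps the Hilbert basis to `v`
  obtain ⟨T, hT⟩ := hunit.star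
  have hTb (n : ℕ) : (T : H →L[ℂ] H) (b n) = v n := by
    refine ext_inner_right ℂ fun f => ?_
    rw [hT, ContinuousLinearMap.star_eq_adjoint, ContinuousLinearMap.adjoint_inner_left, hbA]
  set S : H →L[ℂ] H := ((T⁻¹ : (H →L[ℂ] H)ˣ) : H →L[ℂ] H)
  refine ⟨hd, (‖S‖ ^ 2 + 1)⁻¹, ‖(T : H →L[ℂ] H)‖ ^ 2 + 1, by positivity, by positivity,
    fun s a => ?_⟩
  set x : H := ∑ i ∈ s, a i • b i with hx
  have hxn : ‖x‖ ^ 2 = ∑ i ∈ s, ‖a i‖ ^ 2 := by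
    have h1 : ((‖x‖ ^ 2 : ℝ) : ℂ) = ((∑ i ∈ s, ‖a i‖ ^ 2 : ℝ) : ℂ) := by
      push_cast
      simp only [← Complex.conj_mul']
      rw [← b.orthonormal.inner_sum, ← hx, inner_self_eq_norm_sq_to_K]
      rfl
    exact_mod_cast h1
  have hTx : (T : H →L[ℂ] H) x = ∑ i ∈ s, a i • v i := by
    simp only [hx, map_sum, map_smul, hTb]
  have hSx : S ((T : H →L[ℂ] H) x) = x := by
    rw [← mul_apply_eq_comp, T.inv_mul, one_apply_eq_self]
  rw [← hTx, ← hxn]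
  have h1 := (T : H →L[ℂ] H).le_opNorm x
  have h2 := S.le_opNorm ((T : H →L[ℂ] H) x)
  rw [hSx] at h2
  constructor
  · rw [inv_mul_le_iff₀ (by positivity)]
    nlinarith [pow_le_pow_left₀ (norm_nonneg _) h2 2, sq_nonneg ‖(T : H →L[ℂ] H) x‖]
  · nlinarith [pow_le_pow_left₀ (norm_nonneg _) h1 2, sq_nonneg ‖x‖]

/-! ### Dividing out zeros of entire functions -/

theorem differentiable_dslope {f : ℂ → ℂ} (hf : Differentiable ℂ f) (c : ℂ) :
    Differentiable ℂ (dslope f c) := by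
  rw [← differentiableOn_univ, Complex.differentiableOn_dslope univ_mem]
  exact hf.differentiableOn

theorem dslope_eq_div {f : ℂ → ℂ} {c z : ℂ} (hz : z ≠ c) (hc : f c = 0) :
    dslope f c z = f z / (z - c) := by
  rw [dslope_of_ne _ hz, slope_def_field, hc, sub_zero]

/-- On the circle `|z| = r` the Blaschke factor of the disc with zero `c` has modulus one. -/
theorem norm_sub_mul_eq_norm_sub {r : ℝ} {z c : ℂ} (hz : ‖z‖ = r) :
    ‖(r : ℂ) ^ 2 - starRingEnd ℂ c * z‖ = r * ‖z - c‖ := by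
  have : (r : ℂ) ^ 2 - starRingEnd ℂ c * z = starRingEnd ℂ (z - c) * z := by
    rw [← hz, ← Complex.conj_mul', map_sub]; ring
  rw [this, norm_mul, RCLike.norm_conj, hz, mul_comm]

/-- If `|f| ≤ B` on the circle `|z| = r` and `f` vanishes at the distinct nonzero points
`p₀, …, p_{N-1}`, then `|f(0)| ≤ B ∏ |p_j| / r`. The points are not required to lie in the disc. -/
theorem norm_apply_zero_le_of_zeros {r B : ℝ} (hr : 0 < r) {p : ℕ → ℂ} (hp : Function.Injective p)
    (hp0 : ∀ j, p j ≠ 0) (N : ℕ) {f : ℂ → ℂ} (hf : Differentiable ℂ f)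
    (hB : ∀ z, ‖z‖ = r → ‖f z‖ ≤ B) (hz : ∀ j < N, f (p j) = 0) :
    ‖f 0‖ ≤ B * ∏ j ∈ Finset.range N, (‖p j‖ / r) := by
  induction N generalizing f with
  | zero =>
    rw [Finset.prod_range_zero, mul_one]
    refine Complex.norm_le_of_forall_mem_frontier_norm_le (U := Metric.ball 0 r)
      Metric.isBounded_ball hf.diffContOnCl (fun z hz => hB z ?_) ?_
    · rw [frontier_ball _ hr.ne'] at hz
      simpa using hz
    · exact subset_closure (by simpa using hr)
  | succ N ih =>
    have hfN : f (p N) = 0 := hz N N.lt_succ_self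
    -- trade the zero at `p N` for its reflection in the circle
    set h : ℂ → ℂ := fun z => dslope f (p N) z * (((r : ℂ) ^ 2 - starRingEnd ℂ (p N) * z) / r)
      with hh
    have hd : Differentiable ℂ h := (differentiable_dslope hf _).mul (by fun_prop)
    have hrn : ‖(r : ℂ)‖ = r := by rw [Complex.norm_real, Real.norm_of_nonneg hr.le]
    have hhB (z : ℂ) (hz : ‖z‖ = r) : ‖h z‖ ≤ B := by
      have hn := norm_sub_mul_eq_norm_sub (c := p N) hz
      rw [hh, norm_mul, norm_div, hn, hrn, mul_div_cancel_left₀ _ hr.ne']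
      rcases eq_or_ne z (p N) with rfl | hne
      · rw [sub_self, norm_zero, mul_zero]
        exact (norm_nonneg _).trans (hB _ hz)
      · rw [dslope_eq_div hne hfN, norm_div, div_mul_cancel₀ _ (by simpa [sub_eq_zero] using hne)]
        exact hB z hz
    have h1 := ih hd hhB fun j hj => by
      have hne : p j ≠ p N := hp.ne hj.ne
      rw [hh]
      simp only
      rw [dslope_eq_div hne hfN, hz j (by omega), zero_div, zero_mul]
    have h2 : ‖f 0‖ = ‖h 0‖ * (‖p N‖ / r) := by
      have h3 : ‖p N‖ ≠ 0 := by simpa using hp0 N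
      rw [hh]
      simp only [mul_zero, sub_zero]
      rw [dslope_eq_div (hp0 N).symm hfN, zero_sub, norm_mul, norm_div, norm_div, norm_neg,
        norm_pow, hrn]
      field_simp
    rw [h2, Finset.prod_range_succ, ← mul_assoc]
    gcongr

theorem eq_zero_of_iterate_dslope_eq_zero {f : ℂ → ℂ} (hf : Differentiable ℂ f)
    (h : ∀ n, (Function.swap dslope (0 : ℂ))^[n] f 0 = 0) : f = 0 := by
  obtain ⟨p, hp⟩ := hf.analyticAt 0
  have hp0 : p = 0 := by
    by_contra hne
    exact hp.iterate_dslope_fslope_ne_zero hne (h _)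
  exact (Complex.analyticOnNhd_univ_iff_differentiable.2 hf).eq_of_eventuallyEq
    (Complex.analyticOnNhd_univ_iff_differentiable.2 (differentiable_const 0))
    (hp.locally_zero_iff.2 hp0)

/-! ### Norms of the monomials -/

variable {δ : ℝ} {hδ : 0 < δ}

namespace FockSpace

theorem integrable_conj_mul (φ : ℝ≥0 →o ℝ) (f g : FockSpace φ) :
    Integrable fun z : ℂ => (Real.exp (-2 * φ ‖z‖₊) : ℂ) *
      (starRingEnd ℂ (toFun φ f z) * toFun φ g z) := by
  have h1 : Integrable (fun z => starRingEnd ℂ (toFun φ f z) * toFun φ g z) (fockMeasure φ) :=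
    (memLp_toFun φ g).integrable_mul (memLp_toFun φ f).star |>.congr
      (Eventually.of_forall fun z => by simp [mul_comm])
  rw [fockMeasure, integrable_withDensity_iff_integrable_smul₀' (measurable_weight φ).aemeasurable
    (by simp)] at h1
  refine h1.congr (Eventually.of_forall fun z => ?_)
  simp [ENNReal.toReal_ofReal (Real.exp_pos _).le]

end FockSpace

theorem logWeight_apply (x : ℝ≥0) : logWeight δ hδ x = Real.posLog x ^ (1 + δ) := rfl

theorem integrable_norm_pow_mul_exp (n : ℕ) :
    Integrable fun z : ℂ => ‖z‖ ^ (2 * n) * Real.exp (-2 * logWeight δ hδ ‖z‖₊) := by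
  have h := FockSpace.integrable_conj_mul _ (monomial δ hδ n) (monomial δ hδ n)
  refine h.norm.congr (Eventually.of_forall fun z => ?_)
  simp only [norm_mul, Complex.norm_real, Real.norm_eq_abs, abs_of_pos (Real.exp_pos _),
    RCLike.norm_conj]
  rw [show FockSpace.toFun _ (monomial δ hδ n) z = z ^ n from rfl, norm_pow]
  ring

theorem norm_monomial_sq (n : ℕ) : ‖monomial δ hδ n‖ ^ 2 =
    ∫ z : ℂ, ‖z‖ ^ (2 * n) * Real.exp (-2 * logWeight δ hδ ‖z‖₊) := by
  rw [FockSpace.norm_sq_eq_integral]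
  refine integral_congr_ae (Eventually.of_forall fun z => ?_)
  simp only
  rw [show FockSpace.toFun _ (monomial δ hδ n) z = z ^ n from rfl, norm_pow, ← pow_mul, mul_comm n]

theorem norm_monomial_pos (n : ℕ) : 0 < ‖monomial δ hδ n‖ := by
  rw [norm_pos_iff]
  intro h
  have h1 : FockSpace.toFun _ (monomial δ hδ n) 1 = 0 := by rw [h, map_zero]; rfl
  rw [show FockSpace.toFun _ (monomial δ hδ n) 1 = 1 ^ n from rfl, one_pow] at h1
  exact one_ne_zero h1

theorem exp_logNormSq (n : ℕ) : Real.exp (logNormSq δ hδ n) = ‖monomial δ hδ n‖ ^ 2 :=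
  Real.exp_log (pow_pos (norm_monomial_pos n) 2)

/-- Strict log-convexity of the moments: `|z|ⁿ (|z|² - c)` does not vanish almost everywhere, and
the weighted integral of its square is a quadratic polynomial in `c` with the moments as
coefficients. -/
theorem norm_monomial_sq_mul_lt (n : ℕ) : (‖monomial δ hδ (n + 1)‖ ^ 2) ^ 2 <
    ‖monomial δ hδ n‖ ^ 2 * ‖monomial δ hδ (n + 2)‖ ^ 2 := by
  set M : ℕ → ℝ := fun k => ‖monomial δ hδ k‖ ^ 2 with hM
  have hpos (k : ℕ) : 0 < M k := pow_pos (norm_monomial_pos k) 2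
  -- the minimum point of the quadratic polynomial `c ↦ ∫ |z|²ⁿ (|z|² - c)² e^{-2φ}`
  set c : ℝ := M (n + 1) / M n with hc
  have hc0 : 0 < c := div_pos (hpos _) (hpos _)
  set p : ℂ → ℝ := fun z => ‖z‖ ^ (2 * n) * (‖z‖ ^ 2 - c) ^ 2 *
    Real.exp (-2 * logWeight δ hδ ‖z‖₊) with hp
  have hI (k : ℕ) := integrable_norm_pow_mul_exp (δ := δ) (hδ := hδ) k
  have hpe : p = fun z => ‖z‖ ^ (2 * (n + 2)) * Real.exp (-2 * logWeight δ hδ ‖z‖₊) -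
      2 * c * (‖z‖ ^ (2 * (n + 1)) * Real.exp (-2 * logWeight δ hδ ‖z‖₊)) +
      c ^ 2 * (‖z‖ ^ (2 * n) * Real.exp (-2 * logWeight δ hδ ‖z‖₊)) := by
    ext z; simp only [hp]; ring
  have hpi : Integrable p := by
    rw [hpe]; exact ((hI _).sub ((hI _).const_mul _)).add ((hI _).const_mul _)
  have h1 : ∫ z, p z = M (n + 2) - 2 * c * M (n + 1) + c ^ 2 * M n := by
    simp only [hM, norm_monomial_sq, ← integral_const_mul]
    rw [← integral_sub (hI _) ((hI _).const_mul _), ← integral_add _ ((hI _).const_mul _), hpe]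
    exact (hI _).sub ((hI _).const_mul _)
  have h2 : 0 < ∫ z, p z := by
    rw [integral_pos_iff_support_of_nonneg (fun z => by positivity) hpi]
    have hopen : IsOpen {z : ℂ | c + 1 < ‖z‖} := isOpen_lt continuous_const continuous_norm
    have hne : {z : ℂ | c + 1 < ‖z‖}.Nonempty :=
      ⟨((c + 2 : ℝ) : ℂ), by
        rw [Set.mem_ofPred_eq, Complex.norm_real, Real.norm_of_nonneg (by positivity)]; linarith⟩
    refine (hopen.measure_pos volume hne).trans_le (measure_mono fun z hz => ?_)
    have hz' : c + 1 < ‖z‖ := hz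
    have h3 : 0 < ‖z‖ ^ 2 - c := by nlinarith
    have h4 : 0 < ‖z‖ := by linarith
    exact (by positivity : 0 < p z).ne'
  rw [h1] at h2
  have h5 : c * M n = M (n + 1) := div_mul_cancel₀ _ (hpos n).ne'
  have h6 : M (n + 2) - 2 * c * M (n + 1) + c ^ 2 * M n = M (n + 2) - c * M (n + 1) := by
    rw [← h5]; ring
  rw [h6] at h2
  have h7 := mul_pos (hpos n) h2
  change M (n + 1) ^ 2 < M n * M (n + 2)
  calc M (n + 1) ^ 2 = M n * (c * M (n + 1)) := by rw [← h5]; ring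
    _ < _ := by linarith

/-- The second difference `w_n - 2 w_{n+1} + w_{n+2}` of `w_n = log ‖zⁿ‖²`, centred at `n + 1`. -/
noncomputable def secondDifference (δ : ℝ) (hδ : 0 < δ) (n : ℕ) : ℝ :=
  logNormSq δ hδ n + logNormSq δ hδ (n + 2) - 2 * logNormSq δ hδ (n + 1)

theorem secondDifference_pos (n : ℕ) : 0 < secondDifference δ hδ n := by
  rw [secondDifference, sub_pos, ← Real.exp_lt_exp, two_mul, Real.exp_add, Real.exp_add,
    exp_logNormSq, exp_logNormSq, exp_logNormSq, ← sq]
  exact norm_monomial_sq_mul_lt n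

/-! ### Growth of the second differences -/

/-- The second symmetric difference of `t ^ (1 + δ)` with step `a` is at most `2 δ a² t ^ (δ - 1)`,
by Bernoulli's inequality for the exponent `δ < 1`; the last hypothesis makes this at most `1`. -/
theorem rpow_add_add_rpow_sub_le (hδ : 0 < δ) (hδ1 : δ < 1) {t a : ℝ} (ht : 0 < t) (ha : 0 ≤ a)
    (hat : a ≤ t) (h : 2 * a ^ 2 ≤ t ^ (1 - δ)) :
    (t + a) ^ (1 + δ) + (t - a) ^ (1 + δ) ≤ 2 * t ^ (1 + δ) + 1 := by
  -- Bernoulli's inequality bounds `(1 ± x) ^ (1 + δ)` by `(1 ± x) (1 ± δ x)`, whose sum is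
  -- `2 + 2 δ x²`
  set x := a / t with hx
  have hx0 : 0 ≤ x := by positivity
  have hx1 : x ≤ 1 := (div_le_one ht).2 hat
  have hax : a = t * x := by rw [hx]; field_simp
  have key (y : ℝ) (hy : -1 ≤ y) : (1 + y) ^ (1 + δ) ≤ (1 + y) * (1 + δ * y) := by
    rw [Real.rpow_one_add' (by linarith) (by linarith)]
    exact mul_le_mul_of_nonneg_left (rpow_one_add_le_one_add_mul_self hy hδ.le hδ1.le)
      (by linarith)
  have h1 : (t + a) ^ (1 + δ) = t ^ (1 + δ) * (1 + x) ^ (1 + δ) := by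
    rw [← Real.mul_rpow ht.le (by linarith), hax]; ring_nf
  have h2 : (t - a) ^ (1 + δ) = t ^ (1 + δ) * (1 + -x) ^ (1 + δ) := by
    rw [← Real.mul_rpow ht.le (by linarith), hax]; ring_nf
  have h3 := key x (by linarith)
  have h4 := key (-x) (by linarith)
  have h5 : 0 < t ^ (1 + δ) := Real.rpow_pos_of_pos ht _
  have h6 : t ^ (1 + δ) * t ^ (1 - δ) = t ^ 2 := by
    rw [← Real.rpow_add ht, ← Real.rpow_natCast]; congr 1; push_cast; ring
  have h7 : t ^ (1 + δ) * (2 * x ^ 2) ≤ 1 := by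
    have h8 : t ^ (1 + δ) * (2 * a ^ 2) ≤ t ^ 2 := by
      rw [← h6]; exact mul_le_mul_of_nonneg_left h h5.le
    rw [hax] at h8
    have : t ^ 2 * (t ^ (1 + δ) * (2 * x ^ 2)) ≤ t ^ 2 * 1 := by linarith
    exact le_of_mul_le_mul_left this (by positivity)
  have h9 : t ^ (1 + δ) * (2 * δ * x ^ 2) ≤ t ^ (1 + δ) * (2 * x ^ 2) := by
    gcongr
    nlinarith
  rw [h1, h2]
  have := mul_le_mul_of_nonneg_left (add_le_add h3 h4) h5.le
  linarith

/-- The part of `‖zⁿ‖²` that comes from the disc `|z| < e^T`. -/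
theorem integral_ball_le (T : ℝ) (n : ℕ) :
    ∫ z in Metric.ball (0 : ℂ) (Real.exp T),
      ‖z‖ ^ (2 * n) * Real.exp (-2 * logWeight δ hδ ‖z‖₊) ≤ Real.exp T ^ (2 * n + 2) * Real.pi := by
  have hw (z : ℂ) : 0 ≤ logWeight δ hδ ‖z‖₊ := Real.rpow_nonneg Real.posLog_nonneg _
  have hv : volume (Metric.ball (0 : ℂ) (Real.exp T)) ≠ ⊤ := measure_ball_lt_top.ne
  calc _ ≤ ∫ z in Metric.ball (0 : ℂ) (Real.exp T), Real.exp T ^ (2 * n) := by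
        refine setIntegral_mono_on (integrable_norm_pow_mul_exp n).integrableOn
          (integrableOn_const hv) measurableSet_ball fun z hz => ?_
        have h1 : Real.exp (-2 * logWeight δ hδ ‖z‖₊) ≤ 1 :=
          Real.exp_le_one_iff.2 (by linarith [hw z])
        have h2 : ‖z‖ ^ (2 * n) ≤ Real.exp T ^ (2 * n) :=
          pow_le_pow_left₀ (norm_nonneg _) (by simpa using (mem_ball_zero_iff.1 hz).le) _
        calc _ ≤ Real.exp T ^ (2 * n) * 1 := by gcongr
          _ = _ := mul_one _
    _ = _ := by
        rw [setIntegral_const, Measure.real, Complex.volume_ball, ENNReal.toReal_mul,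
          ENNReal.toReal_pow, ENNReal.toReal_ofReal (Real.exp_pos _).le, ENNReal.coe_toReal,
          NNReal.coe_real_pi, smul_eq_mul]
        ring

/-- A lower bound for `‖zⁿ‖²`, from the integral over a unit disc at distance `e^{2T}` from the
origin. -/
theorem le_norm_monomial_sq (hδ1 : δ ≤ 1) {T : ℝ} (hT : 0 ≤ T) (n : ℕ) :
    Real.exp T ^ (4 * n) * Real.exp (-2 * (2 * T + 2) ^ 2) * Real.pi ≤ ‖monomial δ hδ n‖ ^ 2 := by
  -- on the unit disc around `c` one has `2 T ≤ log |z| ≤ 2 T + 2`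
  set c : ℂ := ((Real.exp T ^ 2 + 1 : ℝ) : ℂ) with hc
  have hcn : ‖c‖ = Real.exp T ^ 2 + 1 := by
    rw [hc, Complex.norm_real, Real.norm_of_nonneg (by positivity)]
  have hT1 : 1 ≤ Real.exp T := Real.one_le_exp hT
  have hv : volume (Metric.ball c 1) ≠ ⊤ := measure_ball_lt_top.ne
  have hpt (z : ℂ) (hz : z ∈ Metric.ball c 1) :
      Real.exp T ^ (4 * n) * Real.exp (-2 * (2 * T + 2) ^ 2) ≤
        ‖z‖ ^ (2 * n) * Real.exp (-2 * logWeight δ hδ ‖z‖₊) := by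
    rw [mem_ball_iff_norm] at hz
    have h1 : Real.exp T ^ 2 ≤ ‖z‖ := by
      have := norm_sub_norm_le c z
      rw [norm_sub_rev] at this
      linarith
    have h2 : ‖z‖ ≤ Real.exp T ^ 2 * 3 := by
      have := norm_sub_norm_le z c
      nlinarith
    have hz1 : 1 ≤ ‖z‖ := (one_le_pow₀ hT1).trans h1
    have h3 : Real.posLog ‖z‖ ≤ 2 * T + 2 := by
      rw [Real.posLog_eq_log (by rwa [abs_norm]), Real.log_le_iff_le_exp (by linarith)]
      refine h2.trans ?_
      rw [Real.exp_add, two_mul T, Real.exp_add, sq]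
      have := Real.add_one_le_exp (2 : ℝ)
      gcongr
      linarith
    have h4 : logWeight δ hδ ‖z‖₊ ≤ (2 * T + 2) ^ 2 := by
      rw [logWeight_apply, coe_nnnorm]
      calc _ ≤ (2 * T + 2) ^ (1 + δ) :=
            Real.rpow_le_rpow Real.posLog_nonneg h3 (by linarith)
        _ ≤ (2 * T + 2) ^ (2 : ℝ) :=
            Real.rpow_le_rpow_of_exponent_le (by linarith) (by linarith)
        _ = _ := Real.rpow_two _
    have h5 : Real.exp T ^ (4 * n) ≤ ‖z‖ ^ (2 * n) := by
      rw [show 4 * n = 2 * (2 * n) by ring, pow_mul]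
      exact pow_le_pow_left₀ (by positivity) h1 _
    exact mul_le_mul h5 (Real.exp_le_exp.2 (by linarith)) (Real.exp_pos _).le (by positivity)
  rw [norm_monomial_sq]
  calc _ = ∫ z in Metric.ball c 1, Real.exp T ^ (4 * n) * Real.exp (-2 * (2 * T + 2) ^ 2) := by
        rw [setIntegral_const, Measure.real, Complex.volume_ball, ENNReal.toReal_mul,
          ENNReal.toReal_pow, ENNReal.toReal_ofReal zero_le_one, ENNReal.coe_toReal,
          NNReal.coe_real_pi, smul_eq_mul]
        ring
    _ ≤ ∫ z in Metric.ball c 1, ‖z‖ ^ (2 * n) * Real.exp (-2 * logWeight δ hδ ‖z‖₊) :=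
        setIntegral_mono_on (integrableOn_const hv) (integrable_norm_pow_mul_exp n).integrableOn
          measurableSet_ball hpt
    _ ≤ _ := setIntegral_le_integral (integrable_norm_pow_mul_exp n)
        (Eventually.of_forall fun z => by positivity)

/-- A form of the Cauchy–Schwarz inequality without square roots. -/
theorem sq_integral_le_mul {α : Type*} [MeasurableSpace α] {μ : Measure α} {f g h : α → ℝ}
    (hf : Integrable f μ) (hg : Integrable g μ) (hh : Integrable h μ) (hf0 : 0 ≤ f) (hg0 : 0 ≤ g)
    (hh0 : 0 ≤ h) (hle : ∀ x, h x ^ 2 ≤ f x * g x) :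
    (∫ x, h x ∂μ) ^ 2 ≤ (∫ x, f x ∂μ) * ∫ x, g x ∂μ := by
  have key (s t : ℝ) (hs : 0 ≤ s) (ht : 0 ≤ t) :
      2 * s * t * ∫ x, h x ∂μ ≤ s ^ 2 * (∫ x, f x ∂μ) + t ^ 2 * ∫ x, g x ∂μ := by
    rw [← integral_const_mul, ← integral_const_mul, ← integral_const_mul,
      ← integral_add (hf.const_mul _) (hg.const_mul _)]
    refine integral_mono (hh.const_mul _) ((hf.const_mul _).add (hg.const_mul _)) fun x => ?_
    simp only
    refine le_of_sq_le_sq ?_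
      (add_nonneg (mul_nonneg (sq_nonneg s) (hf0 x)) (mul_nonneg (sq_nonneg t) (hg0 x)))
    have h1 := mul_le_mul_of_nonneg_left (hle x) (by positivity : 0 ≤ 4 * s ^ 2 * t ^ 2)
    nlinarith [sq_nonneg (s ^ 2 * f x - t ^ 2 * g x)]
  have hF : 0 ≤ ∫ x, f x ∂μ := integral_nonneg hf0
  have hH : 0 ≤ ∫ x, h x ∂μ := integral_nonneg hh0
  rcases hF.eq_or_lt with h0 | h0
  · have h1 : h =ᵐ[μ] 0 := by
      filter_upwards [(integral_eq_zero_iff_of_nonneg hf0 hf).1 h0.symm] with x hx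
      have := hle x
      rw [hx] at this
      simpa using this
    rw [integral_congr_ae h1, ← h0]
    simp
  · have h1 := key _ _ hH hF
    refine le_of_mul_le_mul_left ?_ h0
    nlinarith

/-- `w_n - 2 w_{n+1} + w_{n+2} ≥ 4 a - 4` for every step `a` such that the symmetric difference of
the weight with step `a` is bounded for `|z| ≥ e^T`, where at least half of `‖z^{n+1}‖²` comes from.
-/
theorem exp_mul_norm_monomial_sq_le (hδ1 : δ < 1) {T a : ℝ} {n : ℕ} (hT : 7 ≤ T)
    (hTn : T ^ 2 ≤ n + 1)
    (ha : 0 ≤ a) (haT : a ≤ T) (h : 2 * a ^ 2 ≤ T ^ (1 - δ)) :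
    (Real.exp (2 * a - 2) * ‖monomial δ hδ (n + 1)‖ ^ 2) ^ 2 ≤
      ‖monomial δ hδ n‖ ^ 2 * ‖monomial δ hδ (n + 2)‖ ^ 2 := by
  set F : ℕ → ℂ → ℝ := fun k z => ‖z‖ ^ (2 * k) * Real.exp (-2 * logWeight δ hδ ‖z‖₊) with hF
  have hFi (k : ℕ) : Integrable (F k) := integrable_norm_pow_mul_exp k
  have hF0 (k : ℕ) (z : ℂ) : 0 ≤ F k z := by positivity
  have hM (k : ℕ) : ‖monomial δ hδ k‖ ^ 2 = ∫ z, F k z := norm_monomial_sq k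
  have hea : 0 < Real.exp a := Real.exp_pos a
  -- the dilations by `exp (± a)` leave the product of the two integrals unchanged
  have hprod : ‖monomial δ hδ n‖ ^ 2 * ‖monomial δ hδ (n + 2)‖ ^ 2 =
      (∫ z, F (n + 2) (Real.exp a • z)) * ∫ z, F n ((Real.exp a)⁻¹ • z) := by
    rw [Measure.integral_comp_smul_of_nonneg _ _ _ (hR := hea.le),
      Measure.integral_comp_inv_smul_of_nonneg _ _ hea.le, hM, hM, smul_eq_mul, smul_eq_mul]
    field_simp
  set B : Set ℂ := Metric.ball 0 (Real.exp T) with hB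
  set h' : ℂ → ℝ := Bᶜ.indicator fun z => Real.exp (2 * a - 1) * F (n + 1) z with hh'
  have hh'i : Integrable h' := ((hFi _).const_mul _).indicator measurableSet_ball.compl
  have hcs : (∫ z, h' z) ^ 2 ≤
      (∫ z, F (n + 2) (Real.exp a • z)) * ∫ z, F n ((Real.exp a)⁻¹ • z) := by
    refine sq_integral_le_mul ((hFi _).comp_smul hea.ne') ((hFi _).comp_smul (inv_pos.2 hea).ne')
      hh'i (fun z => hF0 _ _) (fun z => hF0 _ _)
      (Set.indicator_nonneg fun z _ => mul_nonneg (Real.exp_pos _).le (hF0 _ _)) fun z => ?_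
    by_cases hz : z ∈ B
    · rw [hh', Set.indicator_of_notMem (by simpa using hz), zero_pow two_ne_zero]
      exact mul_nonneg (hF0 _ _) (hF0 _ _)
    rw [hh', Set.indicator_of_mem hz]
    replace hz : Real.exp T ≤ ‖z‖ := by simpa [hB] using hz
    have hz0 : 0 < ‖z‖ := (Real.exp_pos _).trans_le hz
    set t := Real.log ‖z‖ with ht
    have htz : ‖z‖ = Real.exp t := (Real.exp_log hz0).symm
    have hTt : T ≤ t := (Real.le_log_iff_exp_le hz0).2 hz
    have hW (u : ℂ) (s : ℝ) (hs : 0 ≤ s) (hu : ‖u‖ = Real.exp s) :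
        logWeight δ hδ ‖u‖₊ = s ^ (1 + δ) := by
      rw [logWeight_apply, coe_nnnorm, hu, Real.posLog_eq_log, Real.log_exp]
      rw [abs_of_pos (Real.exp_pos _)]; exact Real.one_le_exp hs
    have hn1 : ‖Real.exp a • z‖ = Real.exp (t + a) := by
      rw [norm_smul, Real.norm_of_nonneg hea.le, htz, Real.exp_add, mul_comm]
    have hn2 : ‖(Real.exp a)⁻¹ • z‖ = Real.exp (t - a) := by
      rw [norm_smul, norm_inv, Real.norm_of_nonneg hea.le, htz, Real.exp_sub, div_eq_inv_mul]
    simp only [hF]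
    rw [hW z t (by linarith) htz, hW _ _ (by linarith) hn1, hW _ _ (by linarith) hn2, hn1, hn2,
      htz]
    simp only [← Real.exp_nat_mul, ← Real.exp_add]
    rw [Real.exp_le_exp]
    have := rpow_add_add_rpow_sub_le hδ hδ1 (by linarith : 0 < t) ha (by linarith)
      (h.trans (Real.rpow_le_rpow (by linarith) hTt (by linarith)))
    push_cast
    nlinarith
  -- at most half of `‖z^{n+1}‖²` comes from the disc `|z| < e^T`
  have hhalf : (∫ z in B, F (n + 1) z) ≤ ‖monomial δ hδ (n + 1)‖ ^ 2 / 2 := by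
    have h1 : (∫ z in B, F (n + 1) z) ≤ Real.exp T ^ (2 * (n + 1) + 2) * Real.pi :=
      integral_ball_le T (n + 1)
    have h2 := le_norm_monomial_sq (hδ := hδ) hδ1.le (by linarith : 0 ≤ T) (n + 1)
    have h3 : 2 * Real.exp T ^ (2 * (n + 1) + 2) ≤
        Real.exp T ^ (4 * (n + 1)) * Real.exp (-2 * (2 * T + 2) ^ 2) := by
      -- the exponents compare because `1 + 8 (T + 1)² ≤ 2 (T² - 1) T` for `T ≥ 7`
      have h4 : (2 : ℝ) ≤ Real.exp 1 := by linarith [Real.add_one_le_exp (1 : ℝ)]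
      refine (mul_le_mul_of_nonneg_right h4 (by positivity)).trans ?_
      simp only [← Real.exp_nat_mul, ← Real.exp_add]
      rw [Real.exp_le_exp]
      push_cast
      have : T ^ 2 * T ≤ (n + 1) * T := mul_le_mul_of_nonneg_right hTn (by linarith)
      nlinarith [mul_nonneg (sub_nonneg.2 hT) (sub_nonneg.2 hT)]
    have := mul_le_mul_of_nonneg_right h3 Real.pi_pos.le
    linarith
  have hJ : Real.exp (2 * a - 2) * ‖monomial δ hδ (n + 1)‖ ^ 2 ≤ ∫ z, h' z := by
    have h1 : ∫ z, h' z = Real.exp (2 * a - 1) * ∫ z in Bᶜ, F (n + 1) z := by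
      rw [hh', integral_indicator measurableSet_ball.compl, integral_const_mul]
    have h2 := integral_add_compl (s := B) measurableSet_ball (hFi (n + 1))
    rw [← hM] at h2
    have h4 : (2 : ℝ) ≤ Real.exp 1 := by linarith [Real.add_one_le_exp (1 : ℝ)]
    have h5 : Real.exp (2 * a - 1) = Real.exp (2 * a - 2) * Real.exp 1 := by
      rw [← Real.exp_add]; ring_nf
    rw [h1, h5, mul_assoc]
    have h6 : 0 ≤ ∫ z in Bᶜ, F (n + 1) z := integral_nonneg fun z => hF0 _ _
    gcongr
    nlinarith
  rw [hprod]
  exact (pow_le_pow_left₀ (by positivity) hJ 2).trans hcs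

theorem eventually_le_secondDifference (hδ1 : δ < 1) : ∀ᶠ n : ℕ in atTop,
    8 * Real.log (n + 1) - 4 ≤ secondDifference δ hδ n := by
  have hx : Tendsto (fun n : ℕ => (n : ℝ) + 1) atTop atTop :=
    tendsto_atTop_add_const_right _ _ tendsto_natCast_atTop_atTop
  have h1 := hx.eventually ((isLittleO_log_rpow_atTop (by linarith : 0 < (1 - δ) / 4)).bound
    (by norm_num : (0 : ℝ) < 1 / 4))
  have h2 := hx.eventually ((isLittleO_log_rpow_atTop (by norm_num : (0 : ℝ) < 1 / 2)).bound
    (by norm_num : (0 : ℝ) < 1 / 2))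
  filter_upwards [h1, h2, hx.eventually_ge_atTop 49] with n h1 h2 h3
  set x : ℝ := n + 1 with hxn
  have hx0 : 0 ≤ x := by linarith
  have hlog : 0 ≤ Real.log x := Real.log_nonneg (by linarith)
  rw [Real.norm_of_nonneg hlog, Real.norm_of_nonneg (Real.rpow_nonneg hx0 _)] at h1 h2
  rw [← Real.sqrt_eq_rpow] at h2
  have h4 : (√x) ^ (1 - δ) = (x ^ ((1 - δ) / 4)) ^ 2 := by
    rw [Real.sqrt_eq_rpow, ← Real.rpow_mul hx0, ← Real.rpow_natCast, ← Real.rpow_mul hx0]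
    congr 1; push_cast; ring
  -- the mass sits at `log |z| ≥ √(n + 1)`, and the step `2 log (n + 1)` makes `e^{-Δ / 4}` summable
  have h5 := exp_mul_norm_monomial_sq_le (hδ := hδ) hδ1 (T := √x) (a := 2 * Real.log x) (n := n)
    (Real.le_sqrt_of_sq_le (by linarith)) (Real.sq_sqrt hx0).le (by linarith) (by linarith) (by
      rw [h4]
      nlinarith [pow_le_pow_left₀ hlog h1 2])
  rw [← exp_logNormSq, ← exp_logNormSq, ← exp_logNormSq, ← Real.exp_add, ← Real.exp_add,
    ← Real.exp_nat_mul, Real.exp_le_exp] at h5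
  push_cast at h5
  rw [secondDifference]
  linarith

/-! ### The monomial basis and the reproducing kernel -/

theorem toFun_monomial (n : ℕ) (z : ℂ) : FockSpace.toFun _ (monomial δ hδ n) z = z ^ n := rfl

/-- Monomials are orthogonal on discs for a radial weight: the rotation by the angle `π / (m - n)`
changes the sign of the integrand. -/
theorem setIntegral_ball_conj_pow_mul_pow_of_ne {m n : ℕ} (hmn : m ≠ n) (R : ℝ) (φ : ℝ≥0 →o ℝ) :
    ∫ z in Metric.ball (0 : ℂ) R, (Real.exp (-2 * φ ‖z‖₊) : ℂ) *
      (starRingEnd ℂ (z ^ n) * z ^ m) = 0 := by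
  have hd : (m : ℂ) - n ≠ 0 := by rw [sub_ne_zero]; exact_mod_cast hmn
  -- rotation by this angle multiplies the integrand by `-1`
  set c : Circle := Circle.exp (Real.pi / ((m : ℝ) - n)) with hc
  have hc1 : starRingEnd ℂ ((c : ℂ) ^ n) * (c : ℂ) ^ m = -1 := by
    rw [map_pow, hc, Circle.coe_exp, ← Complex.exp_conj, ← Complex.exp_nat_mul,
      ← Complex.exp_nat_mul, ← Complex.exp_add, ← Complex.exp_pi_mul_I]
    congr 1
    simp only [map_mul, Complex.conj_ofReal, Complex.conj_I]
    push_cast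
    field_simp
    ring
  set g : ℂ → ℂ := fun z => (Real.exp (-2 * φ ‖z‖₊) : ℂ) * (starRingEnd ℂ (z ^ n) * z ^ m) with hg
  have hrot (z : ℂ) : g (rotation c z) = -g z := by
    simp only [hg, rotation_apply, nnnorm_mul, mul_pow, map_mul]
    rw [show ‖(c : ℂ)‖₊ = 1 from NNReal.eq (Circle.norm_coe c), one_mul]
    linear_combination (Real.exp (-2 * φ ‖z‖₊) : ℂ) * (starRingEnd ℂ (z ^ n) * z ^ m) * hc1
  have h1 := (rotation c).measurePreserving.setIntegral_preimage_emb
    (rotation c).toHomeomorph.measurableEmbedding g (Metric.ball 0 R)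
  have h2 : (rotation c) ⁻¹' Metric.ball 0 R = Metric.ball 0 R := by
    ext z
    rw [Set.mem_preimage, mem_ball_zero_iff, mem_ball_zero_iff, LinearIsometryEquiv.norm_map]
  rw [h2] at h1
  simp only [hrot, integral_neg] at h1
  exact self_eq_neg.1 h1.symm

/-- The inner product with `zⁿ` is the `n`-th Taylor coefficient times `‖zⁿ‖²`. The Taylor series
can be integrated termwise on discs. -/
theorem inner_monomial_left (n : ℕ) (f : FockSpace (logWeight δ hδ)) :
    ⟪monomial δ hδ n, f⟫_ℂ =
      (n.factorial : ℂ)⁻¹ * iteratedDeriv n (FockSpace.toFun _ f) 0 *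
        ((‖monomial δ hδ n‖ ^ 2 : ℝ) : ℂ) := by
  set a : ℕ → ℂ := fun m => (m.factorial : ℂ)⁻¹ * iteratedDeriv m (FockSpace.toFun _ f) 0 with ha
  have hf (z : ℂ) : HasSum (fun m => a m * z ^ m) (FockSpace.toFun _ f z) := by
    refine (Complex.hasSum_taylorSeries_of_entire (FockSpace.differentiable_toFun _ f) 0
      z).congr_fun fun m => ?_
    simp only [ha, sub_zero, smul_eq_mul]; ring
  set G : ℕ → ℂ → ℂ := fun m z => (Real.exp (-2 * logWeight δ hδ ‖z‖₊) : ℂ) *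
    (starRingEnd ℂ (z ^ n) * z ^ m) with hG
  have hGi (m : ℕ) : Integrable (G m) :=
    FockSpace.integrable_conj_mul _ (monomial δ hδ n) (monomial δ hδ m)
  have hball (R : ℝ≥0) : ∫ z in Metric.ball (0 : ℂ) R, (Real.exp (-2 * logWeight δ hδ ‖z‖₊) : ℂ) *
      (starRingEnd ℂ (z ^ n) * FockSpace.toFun _ f z) =
      a n * ∫ z in Metric.ball (0 : ℂ) R, G n z := by
    have h1 := hasSum_integral_of_summable_integral_norm
      (μ := volume.restrict (Metric.ball (0 : ℂ) R)) (F := fun m z => a m * G m z)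
      (fun m => ((hGi m).const_mul _).integrableOn) (by
        have hs : Summable fun m => ‖a m * (R : ℂ) ^ m‖ := (hf R).summable.norm
        refine Summable.of_nonneg_of_le (fun m => integral_nonneg fun z => norm_nonneg _)
          (fun m => ?_) (hs.mul_right (∫ z in Metric.ball (0 : ℂ) R, ‖G 0 z‖))
        rw [← integral_const_mul]
        refine setIntegral_mono_on ((hGi m).const_mul _).norm.integrableOn
          ((hGi 0).norm.const_mul _).integrableOn measurableSet_ball fun z hz => ?_
        have hz' : ‖z‖ ≤ R := (mem_ball_zero_iff.1 hz).le
        have : ‖z‖ ^ m ≤ (R : ℝ) ^ m := pow_le_pow_left₀ (norm_nonneg _) hz' _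
        simp only [hG, norm_mul, norm_pow, pow_zero, mul_one, RCLike.norm_conj]
        rw [show ‖(R : ℂ)‖ = R by simp]
        calc _ = ‖a m‖ * ‖z‖ ^ m *
              (‖(Real.exp (-2 * logWeight δ hδ ‖z‖₊) : ℂ)‖ * ‖z‖ ^ n) := by ring
          _ ≤ _ := by gcongr)
    have h2 : HasSum (fun m => ∫ z in Metric.ball (0 : ℂ) R, a m * G m z)
        (∫ z in Metric.ball (0 : ℂ) R, a n * G n z) :=
      hasSum_single n fun m hm => by
        rw [integral_const_mul, setIntegral_ball_conj_pow_mul_pow_of_ne hm, mul_zero]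
    rw [← integral_const_mul, ← h1.unique h2]
    refine integral_congr_ae (Eventually.of_forall fun z => ?_)
    refine (HasSum.tsum_eq ?_).symm
    have := ((hf z).mul_left (starRingEnd ℂ (z ^ n))).mul_left
      (Real.exp (-2 * logWeight δ hδ ‖z‖₊) : ℂ)
    refine this.congr_fun fun m => ?_
    simp only [hG]; ring
  have hlim (g : ℂ → ℂ) (hg : Integrable g) :
      Tendsto (fun k : ℕ => ∫ z in Metric.ball (0 : ℂ) (k : ℝ≥0), g z) atTop (𝓝 (∫ z, g z)) := by
    have hU : ⋃ k : ℕ, Metric.ball (0 : ℂ) ((k : ℝ≥0) : ℝ) = Set.univ := by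
      simp
    have := tendsto_setIntegral_of_monotone (μ := volume) (f := g)
      (s := fun k : ℕ => Metric.ball (0 : ℂ) ((k : ℝ≥0) : ℝ)) (fun _ => measurableSet_ball)
      (fun i j hij => Metric.ball_subset_ball (by simpa using hij)) hg.integrableOn
    rwa [hU, setIntegral_univ] at this
  have h3 := hlim _ (FockSpace.integrable_conj_mul _ (monomial δ hδ n) f)
  simp only [toFun_monomial, hball] at h3
  have h4 := (hlim _ (hGi n)).const_mul (a n)
  rw [FockSpace.inner_eq_integral]
  simp only [toFun_monomial]
  rw [tendsto_nhds_unique h3 h4]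
  congr 1
  push_cast
  refine Eq.trans ?_ (inner_self_eq_norm_sq_to_K (𝕜 := ℂ) (monomial δ hδ n))
  rw [FockSpace.inner_eq_integral]
  simp only [toFun_monomial, hG]

theorem eq_zero_of_iteratedDeriv_eq_zero {φ : ℝ≥0 →o ℝ} (f : FockSpace φ)
    (h : ∀ n, iteratedDeriv n (FockSpace.toFun _ f) 0 = 0) : f = 0 := by
  refine FockSpace.toFun_injective _ (funext fun z => ?_)
  have := Complex.taylorSeries_eq_of_entire (FockSpace.differentiable_toFun _ f) 0 z
  simp only [h, smul_zero, tsum_zero] at this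
  rw [← this, map_zero]; rfl

theorem inner_monomial_monomial_of_ne {m n : ℕ} (h : m ≠ n) :
    ⟪monomial δ hδ n, monomial δ hδ m⟫_ℂ = 0 := by
  rw [inner_monomial_left, show FockSpace.toFun _ (monomial δ hδ m) = fun z => z ^ m from rfl]
  have : iteratedDeriv n (fun z : ℂ => z ^ m) 0 = 0 := by
    rw [iteratedDeriv_fun_pow_zero]
    simp [h.symm]
  rw [this]
  simp

/-- The normalized monomials, with arbitrary unimodular factors, form a Hilbert basis of `F_φ`. -/
theorem exists_hilbertBasis_monomial (hδ : 0 < δ) (c : ℕ → Circle) :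
    ∃ b : HilbertBasis ℕ ℂ (FockSpace (logWeight δ hδ)),
      ∀ n, b n = ((c n : ℂ) * (‖monomial δ hδ n‖ : ℂ)⁻¹) • monomial δ hδ n := by
  set e : ℕ → FockSpace (logWeight δ hδ) :=
    fun n => ((c n : ℂ) * (‖monomial δ hδ n‖ : ℂ)⁻¹) • monomial δ hδ n with he
  have hne (n : ℕ) : ‖monomial δ hδ n‖ ≠ 0 := (norm_monomial_pos n).ne'
  have hort : Orthonormal ℂ e := by
    refine ⟨fun n => ?_, fun m n hmn => ?_⟩
    · rw [he, norm_smul, norm_mul, Circle.norm_coe, norm_inv, Complex.norm_real, norm_norm, one_mul,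
        inv_mul_cancel₀ (hne n)]
    · simp only [he, inner_smul_left, inner_smul_right, inner_monomial_monomial_of_ne hmn.symm,
        mul_zero]
  refine ⟨HilbertBasis.mkOfOrthogonalEqBot hort ?_, fun n => by
    rw [HilbertBasis.coe_mkOfOrthogonalEqBot]⟩
  rw [Submodule.eq_bot_iff]
  intro f hf
  refine eq_zero_of_iteratedDeriv_eq_zero f fun n => ?_
  have h1 : ⟪e n, f⟫_ℂ = 0 :=
    Submodule.inner_right_of_mem_orthogonal (Submodule.subset_span (Set.mem_range_self n)) hf
  rw [he, inner_smul_left, inner_monomial_left] at h1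
  have h2 : (c n : ℂ) ≠ 0 := Circle.coe_ne_zero _
  simpa [hne n, h2, Nat.factorial_ne_zero] using h1

theorem inner_kerFun_one_left {φ : ℝ≥0 →o ℝ} (z : ℂ) (f : FockSpace φ) :
    ⟪RKHS.kerFun (FockSpace φ) z 1, f⟫_ℂ = FockSpace.toFun _ f z := by
  rw [RKHS.kerFun_inner]
  simp [FockSpace.coe_eq_toFun]

theorem norm_toFun_le_mul_norm_kerFun {φ : ℝ≥0 →o ℝ} (f : FockSpace φ) (z : ℂ) :
    ‖FockSpace.toFun _ f z‖ ≤ ‖f‖ * ‖RKHS.kerFun (FockSpace φ) z 1‖ := by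
  rw [← inner_kerFun_one_left, mul_comm]
  exact norm_inner_le_norm _ _

theorem norm_kerFun_pos (z : ℂ) : 0 < ‖RKHS.kerFun (FockSpace (logWeight δ hδ)) z 1‖ := by
  have h := norm_toFun_le_mul_norm_kerFun (monomial δ hδ 0) z
  rw [toFun_monomial, pow_zero, norm_one] at h
  exact pos_of_mul_pos_right (zero_lt_one.trans_le h) (norm_nonneg _)

theorem hasSum_norm_kerFun_sq (z : ℂ) :
    HasSum (fun n => ‖z‖ ^ (2 * n) / ‖monomial δ hδ n‖ ^ 2)
      (‖RKHS.kerFun (FockSpace (logWeight δ hδ)) z 1‖ ^ 2) := by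
  obtain ⟨b, hb⟩ := exists_hilbertBasis_monomial hδ fun _ => 1
  set k := RKHS.kerFun (FockSpace (logWeight δ hδ)) z 1
  have h1 := b.hasSum_inner_mul_inner k k
  rw [inner_self_eq_norm_sq_to_K] at h1
  have h2 : HasSum (fun n => ((‖z‖ ^ (2 * n) / ‖monomial δ hδ n‖ ^ 2 : ℝ) : ℂ))
      ((‖k‖ ^ 2 : ℝ) : ℂ) := by
    push_cast
    refine h1.congr_fun fun n => ?_
    rw [← inner_conj_symm (b n) k, Complex.mul_conj', inner_kerFun_one_left, hb, map_smul]
    simp [toFun_monomial]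
    ring
  exact_mod_cast h2

/-! ### The radii -/

theorem strictMono_logNormSq_sub :
    StrictMono fun n => logNormSq δ hδ (n + 1) - logNormSq δ hδ n :=
  strictMono_nat_of_lt_succ fun n => by
    have := secondDifference_pos (hδ := hδ) n
    rw [secondDifference] at this
    linarith

/-- The increments of `w` tend to infinity because the second differences eventually exceed `1`. -/
theorem tendsto_logNormSq_sub (hδ1 : δ < 1) :
    Tendsto (fun n => logNormSq δ hδ (n + 1) - logNormSq δ hδ n) atTop atTop := by
  have hlog : Tendsto (fun n : ℕ => 8 * Real.log ((n : ℝ) + 1) - 4) atTop atTop :=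
    tendsto_atTop_add_const_right _ _ ((Real.tendsto_log_atTop.comp
      (tendsto_atTop_add_const_right _ _ tendsto_natCast_atTop_atTop)).const_mul_atTop
      (by norm_num))
  obtain ⟨N, hN⟩ := eventually_atTop.1
    ((hlog.eventually_ge_atTop 1).and (eventually_le_secondDifference (hδ := hδ) hδ1))
  have h1 (j : ℕ) : logNormSq δ hδ (N + 1) - logNormSq δ hδ N + j ≤
      logNormSq δ hδ (j + N + 1) - logNormSq δ hδ (j + N) := by
    induction j with
    | zero => simp
    | succ j ih =>
      have h2 := hN (j + N) (by omega)
      rw [secondDifference] at h2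
      push_cast at h2 ⊢
      rw [show j + 1 + N + 1 = j + N + 2 by ring, show j + 1 + N = j + N + 1 by ring]
      linarith
  rw [← tendsto_add_atTop_iff_nat N]
  exact tendsto_atTop_mono h1 (tendsto_atTop_add_const_left _ _ tendsto_natCast_atTop_atTop)

theorem eventually_exp_neg_secondDifference_le (hδ1 : δ < 1) : ∀ᶠ n : ℕ in atTop,
    Real.exp (-secondDifference δ hδ n / 2) ≤ 1 / 2 := by
  filter_upwards [eventually_le_secondDifference (hδ := hδ) hδ1, eventually_ge_atTop 3]
    with n hn hn3
  have hlog : 1 ≤ Real.log (n + 1) := by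
    rw [Real.le_log_iff_exp_le (by positivity)]
    have : (3 : ℝ) ≤ n := by exact_mod_cast hn3
    linarith [Real.exp_one_lt_d9]
  rw [one_div, ← Real.exp_log (by norm_num : (0 : ℝ) < 2⁻¹), Real.exp_le_exp, Real.log_inv]
  linarith [Real.log_two_lt_d9]

theorem radius_nonneg (n : ℕ) : 0 ≤ radius δ hδ n := by
  cases n with
  | zero => exact le_rfl
  | succ n => exact (Real.exp_pos _).le

theorem radius_succ (n : ℕ) : radius δ hδ (n + 1) =
    Real.exp ((logNormSq δ hδ (n + 2) - logNormSq δ hδ n) / 4) := rfl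

theorem strictMono_radius : StrictMono (radius δ hδ) := by
  refine strictMono_nat_of_lt_succ fun n => ?_
  cases n with
  | zero => exact Real.exp_pos _
  | succ n =>
    rw [radius_succ, radius_succ, Real.exp_lt_exp]
    have h1 := strictMono_logNormSq_sub (hδ := hδ) n.lt_succ_self
    have h2 := strictMono_logNormSq_sub (hδ := hδ) (n + 1).lt_succ_self
    simp only [Nat.succ_eq_add_one, add_assoc] at h1 h2 ⊢
    norm_num at h1 h2 ⊢
    linarith

/-! ### Concentration of the kernels -/

/-- The `m`-th term `|z|²ᵐ / ‖zᵐ‖²` of the kernel at `|z| = r_{n+1}`, in exponential form. -/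
theorem pow_div_norm_monomial_sq_eq (n m : ℕ) :
    radius δ hδ (n + 1) ^ (2 * m) / ‖monomial δ hδ m‖ ^ 2 =
      Real.exp (m * ((logNormSq δ hδ (n + 2) - logNormSq δ hδ n) / 2) - logNormSq δ hδ m) := by
  rw [radius_succ, ← exp_logNormSq, ← Real.exp_nat_mul, ← Real.exp_sub]
  congr 1; push_cast; ring

/-- At `|z| = r_{n+1}` the terms of the kernel decay geometrically to the right of the index `n +
1`. -/
theorem pow_div_norm_monomial_sq_add_le (n j : ℕ) :
    radius δ hδ (n + 1) ^ (2 * (j + (n + 1))) / ‖monomial δ hδ (j + (n + 1))‖ ^ 2 ≤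
      radius δ hδ (n + 1) ^ (2 * (n + 1)) / ‖monomial δ hδ (n + 1)‖ ^ 2 *
        Real.exp (-secondDifference δ hδ n / 2) ^ j := by
  rw [pow_div_norm_monomial_sq_eq, pow_div_norm_monomial_sq_eq, ← Real.exp_nat_mul, ← Real.exp_add,
    Real.exp_le_exp, secondDifference]
  induction j with
  | zero => simp
  | succ j ih =>
    have h := strictMono_logNormSq_sub (hδ := hδ) |>.monotone (by omega : n + 1 ≤ j + (n + 1))
    rw [show j + 1 + (n + 1) = j + (n + 1) + 1 by ring]
    push_cast at ih ⊢
    linarith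

/-- At `|z| = r_{n+1}` the terms of the kernel decay geometrically to the left of the index `n + 1`.
-/
theorem pow_div_norm_monomial_sq_sub_le {n j : ℕ} (hj : j ≤ n + 1) :
    radius δ hδ (n + 1) ^ (2 * (n + 1 - j)) / ‖monomial δ hδ (n + 1 - j)‖ ^ 2 ≤
      radius δ hδ (n + 1) ^ (2 * (n + 1)) / ‖monomial δ hδ (n + 1)‖ ^ 2 *
        Real.exp (-secondDifference δ hδ n / 2) ^ j := by
  rw [pow_div_norm_monomial_sq_eq, pow_div_norm_monomial_sq_eq, ← Real.exp_nat_mul, ← Real.exp_add,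
    Real.exp_le_exp, secondDifference]
  induction j with
  | zero => simp
  | succ j ih =>
    have ih := ih (by omega)
    obtain ⟨i, hi⟩ : ∃ i, n + 1 - j = i + 1 := ⟨n - j, by omega⟩
    have h := strictMono_logNormSq_sub (hδ := hδ) |>.monotone (by omega : i ≤ n)
    rw [show n + 1 - (j + 1) = i by omega]
    rw [hi] at ih
    push_cast at ih ⊢
    linarith

theorem norm_kerFun_sq_le {n : ℕ} {z : ℂ} (hz : ‖z‖ = radius δ hδ (n + 1))
    (hq : Real.exp (-secondDifference δ hδ n / 2) ≤ 1 / 2) :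
    ‖RKHS.kerFun (FockSpace (logWeight δ hδ)) z 1‖ ^ 2 ≤
      (1 + 4 * Real.exp (-secondDifference δ hδ n / 2)) *
        (radius δ hδ (n + 1) ^ (2 * (n + 1)) / ‖monomial δ hδ (n + 1)‖ ^ 2) := by
  set q := Real.exp (-secondDifference δ hδ n / 2) with hqd
  have hq0 : 0 < q := Real.exp_pos _
  have hs := hasSum_norm_kerFun_sq (hδ := hδ) z
  rw [hz] at hs
  set x : ℕ → ℝ := fun m => radius δ hδ (n + 1) ^ (2 * m) / ‖monomial δ hδ m‖ ^ 2 with hx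
  have hx0 : 0 < x (n + 1) := by
    simp only [hx]
    rw [pow_div_norm_monomial_sq_eq]
    exact Real.exp_pos _
  have hg : HasSum (fun j : ℕ => q ^ j) (1 - q)⁻¹ :=
    hasSum_geometric_of_lt_one hq0.le (by linarith)
  have h1 : ∑' j, x (j + (n + 1)) ≤ x (n + 1) * (1 - q)⁻¹ :=
    hasSum_le (fun j => pow_div_norm_monomial_sq_add_le n j)
      ((hasSum_nat_add_iff' (n + 1)).2 hs).summable.hasSum (hg.mul_left _)
  have h2 : ∑ m ∈ Finset.range (n + 1), x m ≤ x (n + 1) * (q * (1 - q)⁻¹) := by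
    rw [← Finset.sum_range_reflect]
    calc _ ≤ ∑ j ∈ Finset.range (n + 1), x (n + 1) * (q * q ^ j) := by
          refine Finset.sum_le_sum fun j hj => ?_
          have hj' := Finset.mem_range.1 hj
          have := pow_div_norm_monomial_sq_sub_le (hδ := hδ) (by omega : j + 1 ≤ n + 1)
          rw [show n + 1 - 1 - j = n + 1 - (j + 1) by omega, ← pow_succ']
          exact this
      _ ≤ _ := by
          rw [← Finset.mul_sum, ← Finset.mul_sum]
          gcongr
          exact sum_le_hasSum _ (fun j _ => by positivity) hg
  have h3 : (1 - q)⁻¹ ≤ 1 + 2 * q := by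
    rw [inv_le_iff_one_le_mul₀ (by linarith)]
    nlinarith
  have h4 := hs.summable.sum_add_tsum_nat_add (n + 1)
  rw [hs.tsum_eq] at h4
  have h5 : q * (1 - q)⁻¹ ≤ 2 * q := by
    have : (1 - q)⁻¹ ≤ 2 := by rw [inv_le_comm₀ (by linarith) two_pos]; linarith
    nlinarith
  change _ ≤ (1 + 4 * q) * x (n + 1)
  nlinarith

theorem norm_normalizedKernel_sub_sq {z : ℂ} {e : FockSpace (logWeight δ hδ)} (he : ‖e‖ = 1)
    {y : ℝ} (hy : FockSpace.toFun _ e z = y) :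
    ‖normalizedKernel (logWeight δ hδ) z - e‖ ^ 2 =
      2 - 2 * (y / ‖RKHS.kerFun (FockSpace (logWeight δ hδ)) z 1‖) := by
  set k := RKHS.kerFun (FockSpace (logWeight δ hδ)) z 1 with hk
  have hn : ‖normalizedKernel (logWeight δ hδ) z‖ = 1 := by
    rw [normalizedKernel, norm_smul, ← hk, Complex.norm_real, norm_inv, norm_norm,
      inv_mul_cancel₀ (norm_kerFun_pos z).ne']
  rw [@norm_sub_sq ℂ, hn, he, normalizedKernel, ← hk, inner_smul_left, inner_kerFun_one_left, hy,
    Complex.conj_ofReal, ← Complex.ofReal_mul, RCLike.re_eq_complex_re, Complex.ofReal_re]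
  ring

/-- The vector `e` is meant to be `z^{n+1} / ‖z^{n+1}‖`, times the unimodular factor that makes its
value at the point positive. -/
theorem norm_normalizedKernel_sub_sq_le {n : ℕ} {z : ℂ} (hz : ‖z‖ = radius δ hδ (n + 1))
    (hq : Real.exp (-secondDifference δ hδ n / 2) ≤ 1 / 2) {e : FockSpace (logWeight δ hδ)}
    (he : ‖e‖ = 1) (hez : FockSpace.toFun _ e z =
      ((radius δ hδ (n + 1) ^ (n + 1) / ‖monomial δ hδ (n + 1)‖ : ℝ) : ℂ)) :
    ‖normalizedKernel (logWeight δ hδ) z - e‖ ^ 2 ≤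
      4 * Real.exp (-secondDifference δ hδ n / 2) := by
  rw [norm_normalizedKernel_sub_sq he hez]
  have hk := norm_kerFun_sq_le hz hq
  have hk0 := norm_kerFun_pos (hδ := hδ) z
  set q := Real.exp (-secondDifference δ hδ n / 2)
  have hq0 : 0 < q := Real.exp_pos _
  set y := radius δ hδ (n + 1) ^ (n + 1) / ‖monomial δ hδ (n + 1)‖ with hy
  have hy0 : 0 < y := div_pos (pow_pos (Real.exp_pos _) _) (norm_monomial_pos _)
  set k := ‖RKHS.kerFun (FockSpace (logWeight δ hδ)) z 1‖
  have hk' : k ≤ (1 + 2 * q) * y := by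
    refine le_of_sq_le_sq (hk.trans ?_) (by positivity)
    rw [mul_comm 2 (n + 1), pow_mul, ← div_pow, ← hy, mul_pow]
    gcongr
    nlinarith
  have h1 : 1 - 2 * q ≤ y / k := by
    rw [le_div_iff₀ hk0]
    calc (1 - 2 * q) * k ≤ (1 - 2 * q) * ((1 + 2 * q) * y) := by gcongr; linarith
      _ ≤ y := by nlinarith [mul_pos hy0 (pow_pos hq0 2)]
  linarith

/-! ### Completeness -/

/-- An entire function that vanishes at points of moduli `r_1, r_2, …` and is `O(‖k_z‖ / |z|)`
vanishes at the origin. The factor `1 / |z|` is what a zero at the origin contributes. -/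
theorem apply_zero_eq_zero_of_zeros (hδ1 : δ < 1) {p : ℕ → ℂ}
    (hp : ∀ j, ‖p j‖ = radius δ hδ (j + 1)) {C : ℝ} (hC : 0 ≤ C) {g : ℂ → ℂ}
    (hg : Differentiable ℂ g) (hz : ∀ j, g (p j) = 0)
    (hgr : ∀ z, 1 ≤ ‖z‖ →
      ‖g z‖ * ‖z‖ ≤ C * ‖RKHS.kerFun (FockSpace (logWeight δ hδ)) z 1‖) : g 0 = 0 := by
  set w := logNormSq δ hδ with hw
  have hrpos (j : ℕ) : 0 < radius δ hδ (j + 1) := Real.exp_pos _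
  have hpinj : Function.Injective p := fun i j hij => by
    have h1 : radius δ hδ (i + 1) = radius δ hδ (j + 1) := by rw [← hp, ← hp, hij]
    exact Nat.succ_injective (strictMono_radius.injective h1)
  have hp0 (j : ℕ) : p j ≠ 0 := by
    rw [← norm_pos_iff, hp]; exact hrpos j
  have htend := tendsto_logNormSq_sub (hδ := hδ) hδ1
  have hsum (N : ℕ) : ∑ j ∈ Finset.range (N + 1), (w (j + 2) - w j) / 4 =
      (w (N + 2) + w (N + 1) - w 1 - w 0) / 4 := by
    induction N with
    | zero => simp
    | succ N ih => rw [Finset.sum_range_succ, ih]; ring_nf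
  have hbound : ∀ᶠ N : ℕ in atTop,
      ‖g 0‖ ≤ 2 * C * Real.exp ((-(w (N + 1) - w N) - w 1 - w 0) / 4) := by
    filter_upwards [htend.eventually_ge_atTop 0, (tendsto_add_atTop_nat 1).eventually
      (htend.eventually_ge_atTop 0),
      eventually_exp_neg_secondDifference_le (hδ := hδ) hδ1] with N h1 h2 hq
    set r := radius δ hδ (N + 1) with hr
    have hr1 : 1 ≤ r := by
      rw [hr, radius_succ]
      refine Real.one_le_exp ?_
      have : logNormSq δ hδ (N + 1 + 1) = logNormSq δ hδ (N + 2) := rfl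
      linarith
    -- `y²` is the largest term of the kernel on the circle `|z| = r`
    set y := Real.exp ((N + 1) * ((w (N + 2) - w N) / 4) - w (N + 1) / 2) with hy
    have hy2 : y ^ 2 = r ^ (2 * (N + 1)) / ‖monomial δ hδ (N + 1)‖ ^ 2 := by
      rw [hr, pow_div_norm_monomial_sq_eq, hy, ← Real.exp_nat_mul]
      congr 1; push_cast; ring
    have hk (z : ℂ) (hzr : ‖z‖ = r) :
        ‖RKHS.kerFun (FockSpace (logWeight δ hδ)) z 1‖ ≤ 2 * y := by
      refine le_of_sq_le_sq ?_ (by positivity)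
      refine (norm_kerFun_sq_le hzr hq).trans ?_
      rw [← hy2]
      nlinarith [sq_nonneg y]
    have hB (z : ℂ) (hzr : ‖z‖ = r) : ‖g z‖ ≤ C * (2 * y) / r := by
      rw [le_div_iff₀ (by linarith), ← hzr]
      exact (hgr z (by rw [hzr]; exact hr1)).trans (mul_le_mul_of_nonneg_left (hk z hzr) hC)
    refine (norm_apply_zero_le_of_zeros (by linarith) hpinj hp0 (N + 1) hg hB
      fun j _ => hz j).trans_eq ?_
    have hprod : ∏ j ∈ Finset.range (N + 1), (‖p j‖ / r) =
        Real.exp ((w (N + 2) + w (N + 1) - w 1 - w 0) / 4) / r ^ (N + 1) := by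
      rw [Finset.prod_div_distrib, Finset.prod_const, Finset.card_range, ← hsum, Real.exp_sum]
      simp only [hp, radius_succ, hw]
    rw [hprod, hr, radius_succ, hy, ← Real.exp_nat_mul]
    have e (a b c d : ℝ) : C * (2 * Real.exp a) / Real.exp b * (Real.exp c / Real.exp d) =
        2 * C * Real.exp (a - b + (c - d)) := by
      rw [Real.exp_add, Real.exp_sub, Real.exp_sub]; ring
    rw [e]
    congr 2
    push_cast
    ring
  have hlim : Tendsto (fun N : ℕ => 2 * C * Real.exp ((-(w (N + 1) - w N) - w 1 - w 0) / 4))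
      atTop (𝓝 (2 * C * 0)) := by
    refine (Real.tendsto_exp_atBot.comp ?_).const_mul _
    refine Tendsto.atBot_div_const (by norm_num) ?_
    simp only [sub_eq_add_neg _ (w 1), sub_eq_add_neg _ (w 0)]
    exact tendsto_atBot_add_const_right _ _ (tendsto_atBot_add_const_right _ _
      (tendsto_neg_atTop_atBot.comp htend))
  rw [mul_zero] at hlim
  exact norm_le_zero_iff.1 (ge_of_tendsto hlim hbound)

/-- Points of moduli `r_0, r_1, …` form a uniqueness set for `F_φ`. All iterated difference
quotients of `f` at the origin satisfy the hypotheses of `apply_zero_eq_zero_of_zeros`, so all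
Taylor coefficients vanish. -/
theorem eq_zero_of_forall_toFun_eq_zero (hδ1 : δ < 1) {p : ℕ → ℂ}
    (hp : ∀ j, ‖p j‖ = radius δ hδ j) (f : FockSpace (logWeight δ hδ))
    (hf : ∀ j, FockSpace.toFun _ f (p j) = 0) : f = 0 := by
  have hp0 : p 0 = 0 := norm_eq_zero.1 (hp 0)
  have hpne (j : ℕ) : p (j + 1) ≠ 0 := by
    rw [← norm_pos_iff, hp]; exact Real.exp_pos _
  set F := FockSpace.toFun _ f with hF
  have hFd : Differentiable ℂ F := FockSpace.differentiable_toFun _ f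
  have hF0 : F 0 = 0 := hp0 ▸ hf 0
  have key (n : ℕ) : Differentiable ℂ ((Function.swap dslope (0 : ℂ))^[n + 1] F) ∧
      (∀ j, (Function.swap dslope (0 : ℂ))^[n + 1] F (p (j + 1)) = 0) ∧
      ∀ z, 1 ≤ ‖z‖ → ‖(Function.swap dslope (0 : ℂ))^[n + 1] F z‖ * ‖z‖ ≤
        ‖f‖ * ‖RKHS.kerFun (FockSpace (logWeight δ hδ)) z 1‖ := by
    induction n with
    | zero =>
      refine ⟨differentiable_dslope hFd 0, fun j => ?_, fun z hz => ?_⟩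
      · change dslope F 0 _ = 0
        rw [dslope_eq_div (hpne j) hF0, hf, zero_div]
      · change ‖dslope F 0 z‖ * _ ≤ _
        have hz0 : z ≠ 0 := norm_pos_iff.1 (by linarith)
        rw [dslope_eq_div hz0 hF0, sub_zero, norm_div, div_mul_cancel₀ _ (norm_ne_zero_iff.2 hz0)]
        exact norm_toFun_le_mul_norm_kerFun f z
    | succ n ih =>
      obtain ⟨h1, h2, h3⟩ := ih
      have h0 := apply_zero_eq_zero_of_zeros hδ1 (fun j => hp (j + 1)) (norm_nonneg f) h1 h2 h3
      rw [Function.iterate_succ_apply']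
      set G := (Function.swap dslope (0 : ℂ))^[n + 1] F
      refine ⟨differentiable_dslope h1 0, fun j => ?_, fun z hz => ?_⟩
      · change dslope G 0 _ = 0
        rw [dslope_eq_div (hpne j) h0, h2, zero_div]
      · change ‖dslope G 0 z‖ * _ ≤ _
        have hz0 : z ≠ 0 := norm_pos_iff.1 (by linarith)
        rw [dslope_eq_div hz0 h0, sub_zero, norm_div, div_mul_cancel₀ _ (norm_ne_zero_iff.2 hz0)]
        exact (le_mul_of_one_le_right (norm_nonneg _) hz).trans (h3 z hz)
  refine FockSpace.toFun_injective _ (Eq.trans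
    (eq_zero_of_iterate_dslope_eq_zero hFd fun n => ?_) (map_zero _).symm)
  cases n with
  | zero => exact hF0
  | succ n =>
    obtain ⟨h1, h2, h3⟩ := key n
    exact apply_zero_eq_zero_of_zeros hδ1 (fun j => hp (j + 1)) (norm_nonneg f) h1 h2 h3

end Fock

open Fock in
theorem mainTheorem3 (δ : ℝ) (hδ : 0 < δ) (hδ_lt : δ < 1) (θ : ℕ → ℝ) :
    Fock.IsRieszBasis fun n : ℕ =>
      Fock.normalizedKernel (Fock.logWeight δ hδ)
        ((Fock.radius δ hδ n : ℂ) * Complex.exp ((θ n : ℂ) * Complex.I)) := by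
  set p : ℕ → ℂ := fun n => (radius δ hδ n : ℂ) * Complex.exp ((θ n : ℂ) * Complex.I) with hp
  have hpn (n : ℕ) : ‖p n‖ = radius δ hδ n := by
    simp only [hp]
    rw [norm_mul, Complex.norm_exp_ofReal_mul_I, mul_one, Complex.norm_real,
      Real.norm_of_nonneg (radius_nonneg n)]
  -- the phases make the `n`-th basis function positive at `λ_n`
  obtain ⟨b, hb⟩ := exists_hilbertBasis_monomial hδ fun n => Circle.exp (-(n * θ n))
  have hbp (n : ℕ) : FockSpace.toFun _ (b n) (p n) =
      ((radius δ hδ n ^ n / ‖monomial δ hδ n‖ : ℝ) : ℂ) := by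
    rw [hb, map_smul, Pi.smul_apply, toFun_monomial, hp, smul_eq_mul, mul_pow, Circle.coe_exp]
    have h1 : Complex.exp (((-(n * θ n) : ℝ) : ℂ) * Complex.I) *
        Complex.exp ((θ n : ℂ) * Complex.I) ^ n = 1 := by
      rw [← Complex.exp_nat_mul, ← Complex.exp_add, ← Complex.exp_zero]
      congr 1; push_cast; ring
    push_cast at h1 ⊢
    linear_combination ((radius δ hδ n : ℂ) ^ n / (‖monomial δ hδ n‖ : ℂ)) * h1
  refine isRieszBasis_of_summable_norm_sub b ?_ ?_
  · rw [← summable_nat_add_iff 1]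
    have hs : Summable fun n : ℕ => 2 * Real.exp 1 * ((n : ℝ) + 1)⁻¹ ^ 2 := by
      have := (summable_nat_add_iff 1).2 (Real.summable_nat_pow_inv.2 one_lt_two)
      refine Summable.mul_left _ (this.congr fun n => ?_)
      push_cast; rw [inv_pow]
    refine hs.of_norm_bounded_eventually_nat ?_
    filter_upwards [eventually_le_secondDifference (hδ := hδ) hδ_lt,
      eventually_exp_neg_secondDifference_le (hδ := hδ) hδ_lt] with n hn hq
    rw [norm_norm]
    refine le_of_sq_le_sq ((norm_normalizedKernel_sub_sq_le (hpn (n + 1)) hq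
      (b.orthonormal.1 (n + 1)) (hbp (n + 1))).trans ?_) (by positivity)
    have hn1 : (0 : ℝ) < (n : ℝ) + 1 := by positivity
    rw [← Real.exp_log (inv_pos.2 hn1), Real.log_inv, ← Real.exp_nat_mul, mul_assoc,
      ← Real.exp_add, mul_pow, ← Real.exp_nat_mul, show (2 : ℝ) ^ 2 = 4 by norm_num]
    gcongr
    push_cast
    linarith
  · rw [Submodule.topologicalClosure_eq_top_iff, Submodule.eq_bot_iff]
    intro f hf
    refine eq_zero_of_forall_toFun_eq_zero hδ_lt hpn f fun n => ?_
    have h1 : ⟪normalizedKernel (logWeight δ hδ) (p n), f⟫_ℂ = 0 :=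
      Submodule.inner_right_of_mem_orthogonal (Submodule.subset_span (Set.mem_range_self n)) hf
    rw [normalizedKernel, inner_smul_left, inner_kerFun_one_left] at h1
    simpa [(norm_kerFun_pos (hδ := hδ) (p n)).ne'] using h1
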